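/- Let $S$, $J$, $R$ be finite sets of sources, resources and routes. Each route $r$ is a nonempty set of resources and belongs to exactly one source $s(r)$ (written $r\in s$), and each source has at least one route. Let $A_{jr}=1$ if $j\in r$ and $A_{jr}=0$ otherwise, let $c_j>0$ be the capacities, let $p,q>1$ with $\frac1p+\frac1q=1$, and let $\gamma\in(0,1)$. For each source let $U_s$ be an increasing, strictly concave, continuously differentiable function on $(0,\infty)$ with $U_s(y)\to\infty$ as $y\to\infty$. Let $\kappa_j:[0,\infty)\to(0,\infty)$ $(j\in J)$ and $\kappa_s:(0,\infty)\to(0,\infty)$ $(s\in S)$ be continuous. Assume that $A$ has full row rank and that (Assumption H) for each $s$ the function $u\mapsto u^{q-1}U_s'(u^q)$ is strictly decreasing on $(0,\infty)$. Let $D_s=(U_s')^{-1}$, and consider on the state space $$\{(\mu,\nu)\in\mathbb R^J\times\mathbb R^S:\ \mu\ge 0,\ 0<\nu_s<\lambda_r \text{ for all } s\in S,\ r\in s\},\qquad \lambda_r=\sum_{j\in r}\mu_j,$$ the system $$\dot\mu_j=\kappa_j(\mu_j)\,(z_j-c_j)^+_{\mu_j},\qquad \dot\nu_s=\kappa_s(\nu_s)\Big(y_s-\sum_{r\in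 s}x_r\Big),$$ where $(b)^+_c=b$ if $c>0$ and $(b)^+_c=\max(0,b)$ if $c=0$, and $$z_j=\sum_{r\ni j}x_r,\qquad x_r=\bar y_{s(r)}\Big(\frac{\gamma U_{s(r)}'(\bar y_{s(r)})}{\lambda_r-\nu_{s(r)}}\Big)^p,\qquad y_s=\bar y_s\Big(\frac{(1-\gamma)U_s'(\bar y_s)}{\nu_s}\Big)^p,$$ $$\bar y_s=D_s\Big(\Big(\gamma^p\sum_{r\in s}(\lambda_r-\nu_s)^{1-p}+(1-\gamma)^p\nu_s^{1-p}\Big)^{\frac1{1-p}}\Big).$$ Then this system has a unique equilibrium point $(\mu^*,\nu^*)$, and it is globally asymptotically stable. That is, with solutions understood in the sense of Carathéodory (locally absolutely continuous, satisfying the equations at almost every time): $(\mu^*,\nu^*)$ is Lyapunov stable; from every initial state there is a solution defined for all $t\ge0$; every solution on a bounded interval $[0,T)$ extends to a solution on $[0,\infty)$; and every solution on $[0,\infty)$ converges to $(\mu^*,\nu^*)$ as $t\to\infty$. -/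

import Mathlib

/-- The data of a multi-path dual congestion control system with finite sets of sources `S`,
resources `J` and routes `R`. -/
structure MultipathSystem (S J R : Type*) where
  /-- the source that a route serves; `r ∈ s` means `source r = s` -/
  source : R → S
  /-- the resources that lie on a route -/
  route : R → Finset J
  /-- capacities of the resources -/
  capacity : J → ℝ
  /-- utility functions; only their values on `(0, ∞)` matter -/
  utility : S → ℝ → ℝ
  /-- the exponent `p` -/
  p : ℝ
  /-- the exponent `q`, conjugate to `p` -/
  q : ℝ
  /-- the mixing weight `γ` -/
  gamma : ℝ
  /-- gains of the resources, as functions of the resource price on `[0, ∞)` -/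
  gainJ : J → ℝ → ℝ
  /-- gains of the sources, as functions of the source variable on `(0, ∞)` -/
  gainS : S → ℝ → ℝ

/-- A state `(μ, ν)`: resource prices `μ_j` and source variables `ν_s`. -/
abbrev PriceState (S J : Type*) : Type _ := (J → ℝ) × (S → ℝ)

/-- The operation `(b)_c^+`: it is `b` if `c > 0` and `max (0, b)` if `c = 0`. -/
noncomputable def posProj (b c : ℝ) : ℝ := if 0 < c then b else max 0 b

namespace MultipathSystem

variable {S J R : Type*}

/-- The standing assumptions on the network, the utilities, the parameters and the gains. -/
structure Standing (M : MultipathSystem S J R) : Prop where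
  /-- every source has a route -/
  source_surjective : Function.Surjective M.source
  /-- every route uses a resource -/
  route_nonempty : ∀ r, (M.route r).Nonempty
  capacity_pos : ∀ j, 0 < M.capacity j
  utility_strictMono : ∀ s, StrictMonoOn (M.utility s) (Set.Ioi 0)
  utility_strictConcave : ∀ s, StrictConcaveOn ℝ (Set.Ioi 0) (M.utility s)
  utility_contDiff : ∀ s, ContDiffOn ℝ 1 (M.utility s) (Set.Ioi 0)
  utility_tendsto : ∀ s, Filter.Tendsto (M.utility s) Filter.atTop Filter.atTop
  one_lt_p : 1 < M.p
  one_lt_q : 1 < M.q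
  conjugate : 1 / M.p + 1 / M.q = 1
  gamma_pos : 0 < M.gamma
  gamma_lt_one : M.gamma < 1
  gainJ_pos : ∀ j, ∀ m : ℝ, 0 ≤ m → 0 < M.gainJ j m
  gainJ_cont : ∀ j, ContinuousOn (M.gainJ j) (Set.Ici 0)
  gainS_pos : ∀ s, ∀ n : ℝ, 0 < n → 0 < M.gainS s n
  gainS_cont : ∀ s, ContinuousOn (M.gainS s) (Set.Ioi 0)

/-- Assumption H: for each source, `u ↦ u ^ (q - 1) * U_s' (u ^ q)` is strictly decreasing
on `(0, ∞)`. -/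
def AssumptionH (M : MultipathSystem S J R) : Prop :=
  ∀ s, StrictAntiOn
    (fun u : ℝ => u ^ (M.q - 1) * deriv (M.utility s) (u ^ M.q)) (Set.Ioi 0)

/-- The 0-1 routing matrix `A`, with `A_{jr} = 1` iff `j ∈ r`. -/
def routingMatrix [DecidableEq J] (M : MultipathSystem S J R) : Matrix J R ℝ :=
  Matrix.of fun j r => if j ∈ M.route r then 1 else 0

/-- The routing matrix has full row rank. -/
def FullRowRank [Fintype J] [Fintype R] [DecidableEq J] (M : MultipathSystem S J R) : Prop :=
  M.routingMatrix.rank = Fintype.card J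

/-- The routes of the source `s`. -/
def routesOf [Fintype R] [DecidableEq S] (M : MultipathSystem S J R) (s : S) : Finset R :=
  Finset.univ.filter fun r => M.source r = s

/-- The route price `λ_r = ∑_{j ∈ r} μ_j`. -/
def routePrice (M : MultipathSystem S J R) (x : PriceState S J) (r : R) : ℝ :=
  ∑ j ∈ M.route r, x.1 j

/-- The state space: all `(μ, ν)` with `μ ≥ 0` and `0 < ν_s < λ_r` whenever `r ∈ s`. -/
def stateSpace (M : MultipathSystem S J R) : Set (PriceState S J) :=
  {x | (∀ j, 0 ≤ x.1 j) ∧ (∀ s, 0 < x.2 s) ∧ ∀ r, x.2 (M.source r) < M.routePrice x r}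

/-- The demand function `D_s`, the inverse of `U_s'` on `(0, ∞)`. -/
noncomputable def demand (M : MultipathSystem S J R) (s : S) : ℝ → ℝ :=
  Function.invFunOn (deriv (M.utility s)) (Set.Ioi 0)

section Dynamics

variable [Fintype R] [DecidableEq S]

/-- The price seen by the source `s`, namely
`(γ^p ∑_{r ∈ s} (λ_r - ν_s)^(1-p) + (1-γ)^p ν_s^(1-p))^(1/(1-p))`. -/
noncomputable def sourcePrice (M : MultipathSystem S J R) (x : PriceState S J) (s : S) : ℝ :=
  (M.gamma ^ M.p * ∑ r ∈ M.routesOf s, (M.routePrice x r - x.2 s) ^ (1 - M.p)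
    + (1 - M.gamma) ^ M.p * x.2 s ^ (1 - M.p)) ^ (1 / (1 - M.p))

/-- The quantity `ȳ_s`. -/
noncomputable def yBar (M : MultipathSystem S J R) (x : PriceState S J) (s : S) : ℝ :=
  M.demand s (M.sourcePrice x s)

/-- The route rate `x_r = ȳ_s (γ U_s'(ȳ_s) / (λ_r - ν_s))^p`, where `s = s(r)`. -/
noncomputable def routeRate (M : MultipathSystem S J R) (x : PriceState S J) (r : R) : ℝ :=
  M.yBar x (M.source r) *
    (M.gamma * deriv (M.utility (M.source r)) (M.yBar x (M.source r))
      / (M.routePrice x r - x.2 (M.source r))) ^ M.p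

/-- The source variable `y_s = ȳ_s ((1 - γ) U_s'(ȳ_s) / ν_s)^p`. -/
noncomputable def sourceRate (M : MultipathSystem S J R) (x : PriceState S J) (s : S) : ℝ :=
  M.yBar x s * ((1 - M.gamma) * deriv (M.utility s) (M.yBar x s) / x.2 s) ^ M.p

/-- The load `z_j = ∑_{r ∋ j} x_r` of the resource `j`. -/
noncomputable def load [DecidableEq J] (M : MultipathSystem S J R) (x : PriceState S J) (j : J) :
    ℝ :=
  ∑ r ∈ Finset.univ.filter (fun r => j ∈ M.route r), M.routeRate x r

/-- The right-hand side of the (undelayed) dual algorithm: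
`μ_j' = κ_j(μ_j) (z_j - c_j)_{μ_j}^+` and `ν_s' = κ_s(ν_s) (y_s - ∑_{r ∈ s} x_r)`. -/
noncomputable def field [DecidableEq J] (M : MultipathSystem S J R) (x : PriceState S J) :
    PriceState S J :=
  (fun j => M.gainJ j (x.1 j) * posProj (M.load x j - M.capacity j) (x.1 j),
   fun s => M.gainS s (x.2 s) * (M.sourceRate x s - ∑ r ∈ M.routesOf s, M.routeRate x r))

variable [DecidableEq J]

/-- An equilibrium point: a state at which the right-hand side vanishes. -/
def IsEquilibrium (M : MultipathSystem S J R) (x : PriceState S J) : Prop :=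
  x ∈ M.stateSpace ∧ M.field x = 0

variable [Fintype S] [Fintype J]

/-- `X` is a Carathéodory solution on the time interval `I`, which is `[0, T)` or `[0, ∞)`:
it stays in the state space and satisfies the integrated equation, that is, it is locally
absolutely continuous and satisfies the differential equation at almost every time. (The
right-hand side jumps where a price reaches zero, so that solutions that are differentiable at
every time need not exist.) -/
def IsSolutionOn (M : MultipathSystem S J R) (I : Set ℝ) (X : ℝ → PriceState S J) : Prop :=
  ∀ t ∈ I, X t ∈ M.stateSpace ∧
    IntervalIntegrable (fun τ => M.field (X τ)) MeasureTheory.volume 0 t ∧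
    X t = X 0 + ∫ τ in (0 : ℝ)..t, M.field (X τ)

/-- Global asymptotic stability of the point `e`. Solutions are not assumed to be unique, so
all of them are considered. -/
structure IsGloballyAsymptoticallyStable (M : MultipathSystem S J R) (e : PriceState S J) :
    Prop where
  /-- Lyapunov stability -/
  stable : ∀ ε > 0, ∃ δ > 0, ∀ T > 0, ∀ X : ℝ → PriceState S J,
    M.IsSolutionOn (Set.Ico 0 T) X → dist (X 0) e < δ → ∀ t ∈ Set.Ico 0 T, dist (X t) e < ε
  /-- a solution for all times starts at every state -/
  exists_solution : ∀ x₀ ∈ M.stateSpace, ∃ X : ℝ → PriceState S J,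
    M.IsSolutionOn (Set.Ici 0) X ∧ X 0 = x₀
  /-- no solution breaks down in finite time -/
  extend : ∀ T > 0, ∀ X : ℝ → PriceState S J, M.IsSolutionOn (Set.Ico 0 T) X →
    ∃ Y : ℝ → PriceState S J, M.IsSolutionOn (Set.Ici 0) Y ∧ Set.EqOn Y X (Set.Ico 0 T)
  /-- every solution, whatever its initial state, converges to `e` -/
  attractive : ∀ X : ℝ → PriceState S J, M.IsSolutionOn (Set.Ici 0) X →
    Filter.Tendsto X Filter.atTop (nhds e)

end Dynamics

end MultipathSystem

/-! The system is a projected gradient flow, with state-dependent positive gains, of a convex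
function, and that function is a Lyapunov function. Let ψ_s(w) = sup_y (U_s(y) - w y), let w_s be
the CES aggregate of the input prices ν_s and λ_r - ν_s, and put V = ∑ ψ_s(w_s) + ∑ c_j μ_j
(`potential`). The rates y_s and x_r are the cheapest inputs for the output ȳ_s, so by the envelope
principle c_j - z_j and ∑ x_r - y_s are the components of a gradient of V. Assumption H serves only
to make U_s' map onto (0, ∞), so that D_s is a true inverse.

V is never differentiated. What is used is the tangent inequality `potential_tangent_le`, which
comes from cost minimization and concavity of U_s, together with continuity of `gradient`. Equality
forces equal input prices, hence equal μ by full row rank (`eq_of_potential_le_tangent`). Since U_s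
is unbounded above and c > 0, the sublevel sets of V lie in compact subsets of the state space
(`sublevel_subset_compact`). So V has a minimizer; the minimizer is an equilibrium, and every
equilibrium is the unique minimizer.

Along a solution V falls at least by the integral of ∑ κ_j ((z_j - c_j)^+)² + ∑ κ_s (y_s - ∑ x_r)²
(`potential_sub_le`), where ^+ is the projection at μ_j. The projection is discontinuous, but this
dissipation is still bounded below on compact sets without equilibria (`exists_dissipation_bound`).
Stability and convergence follow.

Existence is a separate matter, because the right-hand side jumps where a price vanishes. Limits of
projected Euler schemes are Lipschitz curves that solve the equation almost everywhere
(`exists_projectedEuler_limit`, `integral_eq_of_isLocallyDrivenBy`), and the decay of V keeps them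
in a compact set for all times. The same confinement gives any solution on [0, T) a limit at T, from
which it can be continued. -/

open Set Filter Topology MeasureTheory

/-! ### CES price aggregates and cost minimization -/

/-- The constant elasticity of substitution price aggregate with weights `g`. -/
noncomputable def cesPrice {ι : Type*} (t : Finset ι) (p : ℝ) (g a : ι → ℝ) : ℝ :=
  (∑ i ∈ t, g i ^ p * a i ^ (1 - p)) ^ (1 / (1 - p))

theorem strictConvexOn_rpow_one_sub {p : ℝ} (hp : 1 < p) :
    StrictConvexOn ℝ (Ioi 0) fun x : ℝ => x ^ (1 - p) := by
  refine StrictMonoOn.strictConvexOn_of_deriv (convex_Ioi 0) ?_ ?_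
  · exact fun x hx => (Real.continuousAt_rpow_const _ _ (Or.inl (ne_of_gt hx))).continuousWithinAt
  · rw [interior_Ioi]
    intro x hx y hy hxy
    rw [Real.deriv_rpow_const, Real.deriv_rpow_const]
    have h := Real.rpow_lt_rpow_of_neg hx hxy (show (1 - p - 1) < 0 by linarith)
    nlinarith

namespace cesPrice

variable {ι : Type*} {t : Finset ι} {p : ℝ} {g a b : ι → ℝ}

theorem sum_pos (ht : t.Nonempty) (hg : ∀ i ∈ t, 0 < g i) (ha : ∀ i ∈ t, 0 < a i) :
    0 < ∑ i ∈ t, g i ^ p * a i ^ (1 - p) :=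
  Finset.sum_pos (fun i hi => mul_pos (Real.rpow_pos_of_pos (hg i hi) _)
    (Real.rpow_pos_of_pos (ha i hi) _)) ht

theorem pos (ht : t.Nonempty) (hg : ∀ i ∈ t, 0 < g i) (ha : ∀ i ∈ t, 0 < a i) :
    0 < cesPrice t p g a :=
  Real.rpow_pos_of_pos (sum_pos ht hg ha) _

theorem rpow_one_sub (hp : 1 < p) (ht : t.Nonempty) (hg : ∀ i ∈ t, 0 < g i)
    (ha : ∀ i ∈ t, 0 < a i) :
    cesPrice t p g a ^ (1 - p) = ∑ i ∈ t, g i ^ p * a i ^ (1 - p) := by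
  rw [cesPrice, ← Real.rpow_mul (sum_pos ht hg ha).le, one_div_mul_cancel (by linarith),
    Real.rpow_one]

/-- A sum of positive terms dominates each term, and the outer exponent 1/(1-p) is negative. This
later turns a lower bound on the aggregate into a lower bound on every single input price. -/
theorem le_mul (hp : 1 < p) (hg : ∀ i ∈ t, 0 < g i) (ha : ∀ i ∈ t, 0 < a i) {i : ι}
    (hi : i ∈ t) : cesPrice t p g a ≤ g i ^ (p / (1 - p)) * a i := by
  have h1 : g i ^ p * a i ^ (1 - p) ≤ ∑ i ∈ t, g i ^ p * a i ^ (1 - p) :=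
    Finset.single_le_sum (f := fun i => g i ^ p * a i ^ (1 - p)) (fun j hj =>
      (mul_pos (Real.rpow_pos_of_pos (hg j hj) _) (Real.rpow_pos_of_pos (ha j hj) _)).le) hi
  have h2 : 0 < g i ^ p * a i ^ (1 - p) :=
    mul_pos (Real.rpow_pos_of_pos (hg i hi) _) (Real.rpow_pos_of_pos (ha i hi) _)
  have h3 : 1 / (1 - p) ≤ 0 := by
    apply div_nonpos_of_nonneg_of_nonpos <;> linarith
  refine (Real.rpow_le_rpow_of_nonpos h2 h1 h3).trans_eq ?_
  rw [Real.mul_rpow (Real.rpow_pos_of_pos (hg i hi) _).le (Real.rpow_pos_of_pos (ha i hi) _).le,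
    ← Real.rpow_mul (hg i hi).le, ← Real.rpow_mul (ha i hi).le, mul_one_div,
    mul_one_div_cancel (by linarith), Real.rpow_one]

theorem const_mul {c : ℝ} (hp : 1 < p) (hc : 0 < c) (hg : ∀ i ∈ t, 0 < g i)
    (ha : ∀ i ∈ t, 0 < a i) (hb : ∀ i ∈ t, b i = c * a i) :
    cesPrice t p g b = c * cesPrice t p g a := by
  have h : ∑ i ∈ t, g i ^ p * b i ^ (1 - p) = c ^ (1 - p) * ∑ i ∈ t, g i ^ p * a i ^ (1 - p) := by
    rw [Finset.mul_sum]
    refine Finset.sum_congr rfl fun i hi => ?_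
    rw [hb i hi, Real.mul_rpow hc.le (ha i hi).le]
    ring
  rw [cesPrice, h, Real.mul_rpow (Real.rpow_pos_of_pos hc _).le
    (Finset.sum_nonneg fun i hi => (mul_pos (Real.rpow_pos_of_pos (hg i hi) _)
      (Real.rpow_pos_of_pos (ha i hi) _)).le), ← Real.rpow_mul hc.le,
    mul_one_div_cancel (by linarith), Real.rpow_one, cesPrice]

/-- The shares of the inputs in the cost of a unit of output. -/
theorem mul_demand_eq (ht : t.Nonempty) (hg : ∀ i ∈ t, 0 < g i)
    (ha : ∀ i ∈ t, 0 < a i) {i : ι} (hi : i ∈ t) :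
    (g i * cesPrice t p g a / a i) ^ p =
      cesPrice t p g a * (g i ^ p * a i ^ (1 - p) * cesPrice t p g a ^ (p - 1)) / a i := by
  have hw := pos (p := p) ht hg ha
  rw [Real.div_rpow (mul_pos (hg i hi) hw).le (ha i hi).le, Real.mul_rpow (hg i hi).le hw.le,
    Real.rpow_sub (ha i hi), Real.rpow_sub hw, Real.rpow_one, Real.rpow_one]
  have := ha i hi
  field_simp

theorem sum_share (hp : 1 < p) (ht : t.Nonempty) (hg : ∀ i ∈ t, 0 < g i)
    (ha : ∀ i ∈ t, 0 < a i) :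
    ∑ i ∈ t, g i ^ p * a i ^ (1 - p) * cesPrice t p g a ^ (p - 1) = 1 := by
  have hw := pos (p := p) ht hg ha
  rw [← Finset.sum_mul, ← rpow_one_sub hp ht hg ha, ← Real.rpow_add hw]
  simp

theorem sum_mul_demand (hp : 1 < p) (ht : t.Nonempty) (hg : ∀ i ∈ t, 0 < g i)
    (ha : ∀ i ∈ t, 0 < a i) :
    ∑ i ∈ t, a i * (g i * cesPrice t p g a / a i) ^ p = cesPrice t p g a := by
  calc _ = ∑ i ∈ t, cesPrice t p g a * (g i ^ p * a i ^ (1 - p) * cesPrice t p g a ^ (p - 1)) := by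
        refine Finset.sum_congr rfl fun i hi => ?_
        rw [mul_demand_eq ht hg ha hi]
        have := ha i hi
        field_simp
    _ = _ := by rw [← Finset.mul_sum, sum_share hp ht hg ha, mul_one]

/-- The unit demands at the prices `a` cost at least the unit price at the prices `b`, and more
unless the prices are proportional. -/
theorem le_sum_mul_demand (hp : 1 < p) (ht : t.Nonempty) (hg : ∀ i ∈ t, 0 < g i)
    (ha : ∀ i ∈ t, 0 < a i) (hb : ∀ i ∈ t, 0 < b i) :
    cesPrice t p g b ≤ ∑ i ∈ t, b i * (g i * cesPrice t p g a / a i) ^ p ∧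
    (∑ i ∈ t, b i * (g i * cesPrice t p g a / a i) ^ p ≤ cesPrice t p g b →
      ∃ c, 0 < c ∧ ∀ i ∈ t, b i = c * a i) := by
  set w := cesPrice t p g a with hw_def
  have hw : 0 < w := pos ht hg ha
  have hw' : 0 < cesPrice t p g b := pos ht hg hb
  -- The θ are the cost shares at the prices `a`, which sum to 1, and the ρ are the price ratios.
  -- The cost at the prices `b` is w times the θ-mean of ρ, while the aggregate at `b` is w times
  -- the θ-power mean of ρ of order 1-p, so the claim is Jensen's inequality for x ↦ x^(1-p).
  set θ : ι → ℝ := fun i => g i ^ p * a i ^ (1 - p) * w ^ (p - 1) with hθ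
  set ρ : ι → ℝ := fun i => b i / a i with hρ
  have hθpos : ∀ i ∈ t, 0 < θ i := fun i hi =>
    mul_pos (mul_pos (Real.rpow_pos_of_pos (hg i hi) _) (Real.rpow_pos_of_pos (ha i hi) _))
      (Real.rpow_pos_of_pos hw _)
  have hρpos : ∀ i ∈ t, ρ i ∈ Ioi (0 : ℝ) := fun i hi => div_pos (hb i hi) (ha i hi)
  have hθ1 : ∑ i ∈ t, θ i = 1 := sum_share hp ht hg ha
  have hsum : ∑ i ∈ t, b i * (g i * w / a i) ^ p = w * ∑ i ∈ t, θ i • ρ i := by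
    rw [Finset.mul_sum]
    refine Finset.sum_congr rfl fun i hi => ?_
    rw [mul_demand_eq ht hg ha hi, ← hw_def, smul_eq_mul]
    simp only [hθ, hρ]
    ring
  have hm : 0 < ∑ i ∈ t, θ i • ρ i :=
    Finset.sum_pos (fun i hi => mul_pos (hθpos i hi) (hρpos i hi)) ht
  have hpow : ∑ i ∈ t, θ i • ρ i ^ (1 - p) = (cesPrice t p g b / w) ^ (1 - p) := by
    rw [Real.div_rpow hw'.le hw.le, rpow_one_sub hp ht hg hb, Finset.sum_div]
    refine Finset.sum_congr rfl fun i hi => ?_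
    simp only [hθ, hρ, smul_eq_mul]
    rw [Real.div_rpow (hb i hi).le (ha i hi).le, ← neg_sub 1 p, Real.rpow_neg hw.le]
    have := (Real.rpow_pos_of_pos (ha i hi) (1 - p)).ne'
    have := (Real.rpow_pos_of_pos hw (1 - p)).ne'
    field_simp
  have hconv := strictConvexOn_rpow_one_sub hp
  have hJ := hconv.convexOn.map_sum_le (fun i hi => (hθpos i hi).le) hθ1 hρpos
  rw [hpow] at hJ
  have key : cesPrice t p g b / w ≤ ∑ i ∈ t, θ i • ρ i :=
    (Real.rpow_le_rpow_iff_of_neg hm (div_pos hw' hw) (by linarith)).1 hJ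
  refine ⟨?_, fun h => ?_⟩
  · rw [hsum]
    rwa [div_le_iff₀' hw] at key
  · rw [hsum] at h
    rw [← le_div_iff₀' hw] at h
    -- Equality in the strict form of Jensen's inequality makes all ratios equal.
    have h2 := hconv.eq_of_le_map_sum hθpos hθ1 hρpos (by
      rw [hpow]
      exact Real.rpow_le_rpow_of_nonpos hm h (by linarith))
    obtain ⟨k, hk⟩ := ht
    refine ⟨ρ k, hρpos k hk, fun i hi => ?_⟩
    rw [← h2 hi hk]
    have := ha i hi
    simp only [hρ]
    field_simp

end cesPrice

/-! ### Marginal utility, demand and indirect utility -/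

namespace MultipathSystem

variable {S J R : Type*} {M : MultipathSystem S J R}

section Utility

theorem Standing.hasDerivAt_utility (hM : M.Standing) (s : S) {y : ℝ} (hy : 0 < y) :
    HasDerivAt (M.utility s) (deriv (M.utility s) y) y :=
  (((hM.utility_contDiff s).differentiableOn one_ne_zero).differentiableAt
    (Ioi_mem_nhds hy)).hasDerivAt

theorem Standing.continuousOn_deriv_utility (hM : M.Standing) (s : S) :
    ContinuousOn (deriv (M.utility s)) (Ioi 0) :=
  (hM.utility_contDiff s).continuousOn_deriv_of_isOpen isOpen_Ioi le_rfl

theorem Standing.utility_lt_tangent (hM : M.Standing) (s : S) {y y₀ : ℝ} (hy : 0 < y)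
    (hy₀ : 0 < y₀) (hne : y ≠ y₀) :
    M.utility s y < M.utility s y₀ + deriv (M.utility s) y₀ * (y - y₀) := by
  have hd := hM.hasDerivAt_utility s hy₀
  rcases lt_or_gt_of_ne hne with h | h
  · have := (hM.utility_strictConcave s).lt_slope_of_hasDerivAt hy hy₀ h hd
    rw [slope_def_field, lt_div_iff₀ (by linarith)] at this
    linarith
  · have := (hM.utility_strictConcave s).slope_lt_of_hasDerivAt hy₀ hy h hd
    rw [slope_def_field, div_lt_iff₀ (by linarith)] at this
    linarith

theorem Standing.deriv_utility_pos (hM : M.Standing) (s : S) {y : ℝ} (hy : 0 < y) :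
    0 < deriv (M.utility s) y := by
  have h1 := hM.utility_strictMono s (show y ∈ Ioi 0 from hy) (show y + 1 ∈ Ioi 0 by
    simp only [mem_Ioi]; linarith) (by linarith)
  have h2 := hM.utility_lt_tangent s (show 0 < y + 1 by linarith) hy (by linarith)
  linarith

theorem Standing.deriv_utility_strictAnti (hM : M.Standing) (s : S) :
    StrictAntiOn (deriv (M.utility s)) (Ioi 0) := by
  intro x hx y hy hxy
  have h1 := hM.utility_lt_tangent s hx hy hxy.ne
  have h2 := hM.utility_lt_tangent s hy hx hxy.ne'
  nlinarith

/-- Assumption H bounds the marginal utility by a negative power at infinity and at zero. -/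
theorem Standing.rpow_mul_deriv_strictAnti (hM : M.Standing) (hH : M.AssumptionH) (s : S) :
    StrictAntiOn (fun v : ℝ => v ^ (1 / M.p) * deriv (M.utility s) v) (Ioi 0) := by
  have hq := hM.one_lt_q
  have hq0 : 0 < M.q := by linarith
  have hexp : 1 / M.q * (M.q - 1) = 1 / M.p := by
    have := hM.conjugate
    field_simp at this ⊢
    linarith
  intro x hx y hy hxy
  have hx' : 0 < x := hx
  have hy' : 0 < y := hy
  have h := hH s (show x ^ (1 / M.q) ∈ Ioi 0 from Real.rpow_pos_of_pos hx _)
    (show y ^ (1 / M.q) ∈ Ioi 0 from Real.rpow_pos_of_pos hy _)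
    (Real.rpow_lt_rpow hx'.le hxy (by positivity))
  simp only [← Real.rpow_mul hx'.le, ← Real.rpow_mul hy'.le, hexp,
    one_div_mul_cancel hq0.ne', Real.rpow_one] at h
  exact h

/-- With k = U_s'(1), the monotonicity of v^(1/p) U_s'(v) gives U_s'(v) > k v^(-1/p) for v < 1 and
the reverse for v > 1. So the marginal utility takes arbitrarily large and arbitrarily small values,
and the intermediate value theorem applies. -/
theorem Standing.deriv_utility_surjOn (hM : M.Standing) (hH : M.AssumptionH) (s : S) :
    SurjOn (deriv (M.utility s)) (Ioi 0) (Ioi 0) := by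
  have hp : 0 < M.p := by linarith [hM.one_lt_p]
  have hp' : 0 < 1 / M.p := by positivity
  have hmono := hM.rpow_mul_deriv_strictAnti hH s
  set k := deriv (M.utility s) 1
  have hk : 0 < k := hM.deriv_utility_pos s one_pos
  intro w hw
  have hw : 0 < w := hw
  have hlow : ∃ a > 0, w ≤ deriv (M.utility s) a := by
    -- The number (k/w)^p solves k v^(-1/p) = w; the cap 1/2 keeps the point strictly below 1.
    refine ⟨min (1 / 2) ((k / w) ^ M.p), by positivity, ?_⟩
    set a := min (1 / 2) ((k / w) ^ M.p)
    have ha : 0 < a := by positivity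
    have h := hmono (show a ∈ Ioi 0 from ha) (mem_Ioi.2 (one_pos (α := ℝ)))
      ((min_le_left _ _).trans_lt (by norm_num))
    simp only [Real.one_rpow, one_mul] at h
    have h2 : a ^ (1 / M.p) ≤ k / w := by
      calc a ^ (1 / M.p) ≤ ((k / w) ^ M.p) ^ (1 / M.p) :=
            Real.rpow_le_rpow ha.le (min_le_right _ _) hp'.le
        _ = k / w := by
            rw [← Real.rpow_mul (by positivity), mul_one_div_cancel hp.ne', Real.rpow_one]
    have h3 := hM.deriv_utility_pos s ha
    have h4 : k < k / w * deriv (M.utility s) a := h.trans_le (by gcongr)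
    rw [div_mul_eq_mul_div, lt_div_iff₀ hw] at h4
    exact (lt_of_mul_lt_mul_left h4 hk.le).le
  have hhigh : ∃ b > 0, deriv (M.utility s) b ≤ w := by
    refine ⟨max 2 ((k / w) ^ M.p), by positivity, ?_⟩
    set b := max 2 ((k / w) ^ M.p)
    have hb : 0 < b := by positivity
    have h := hmono (mem_Ioi.2 (one_pos (α := ℝ))) (show b ∈ Ioi 0 from hb)
      ((by norm_num : (1 : ℝ) < 2).trans_le (le_max_left _ _))
    simp only [Real.one_rpow, one_mul] at h
    have h2 : k / w ≤ b ^ (1 / M.p) := by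
      calc k / w = ((k / w) ^ M.p) ^ (1 / M.p) := by
            rw [← Real.rpow_mul (by positivity), mul_one_div_cancel hp.ne', Real.rpow_one]
        _ ≤ b ^ (1 / M.p) := Real.rpow_le_rpow (by positivity) (le_max_right _ _) hp'.le
    have h3 := hM.deriv_utility_pos s hb
    have h4 : k / w * deriv (M.utility s) b < k := lt_of_le_of_lt (by gcongr) h
    rw [div_mul_eq_mul_div, div_lt_iff₀ hw] at h4
    exact (lt_of_mul_lt_mul_left h4 hk.le).le
  obtain ⟨a, ha, hwa⟩ := hlow
  obtain ⟨b, hb, hwb⟩ := hhigh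
  have hsub : uIcc b a ⊆ Ioi 0 := fun z hz => lt_of_lt_of_le (lt_inf_iff.2 ⟨hb, ha⟩) hz.1
  obtain ⟨y, hy, hyw⟩ := intermediate_value_uIcc ((hM.continuousOn_deriv_utility s).mono hsub)
    (show w ∈ uIcc _ _ from mem_uIcc.2 (Or.inl ⟨hwb, hwa⟩))
  exact ⟨y, hsub hy, hyw⟩

theorem Standing.demand_pos (hM : M.Standing) (hH : M.AssumptionH) (s : S) {w : ℝ} (hw : 0 < w) :
    0 < M.demand s w :=
  Function.invFunOn_mem (hM.deriv_utility_surjOn hH s hw)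

theorem Standing.deriv_utility_demand (hM : M.Standing) (hH : M.AssumptionH) (s : S) {w : ℝ}
    (hw : 0 < w) : deriv (M.utility s) (M.demand s w) = w :=
  Function.invFunOn_eq (hM.deriv_utility_surjOn hH s hw)

theorem Standing.demand_deriv_utility (hM : M.Standing) (hH : M.AssumptionH) (s : S) {y : ℝ}
    (hy : 0 < y) : M.demand s (deriv (M.utility s) y) = y := by
  have hw := hM.deriv_utility_pos s hy
  exact (hM.deriv_utility_strictAnti s).injOn (hM.demand_pos hH s hw) hy
    (hM.deriv_utility_demand hH s hw)

/-- A monotone function whose image contains a neighbourhood of its value at a point is continuous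
there. The demand is antitone, hence the sign change, and it is onto (0, ∞) because every y is the
demand at U_s'(y). -/
theorem Standing.continuousOn_demand (hM : M.Standing) (hH : M.AssumptionH) (s : S) :
    ContinuousOn (M.demand s) (Ioi 0) := by
  have hanti : AntitoneOn (M.demand s) (Ioi 0) := by
    intro v hv w hw hvw
    by_contra! hlt
    have := hM.deriv_utility_strictAnti s (hM.demand_pos hH s hv) (hM.demand_pos hH s hw) hlt
    rw [hM.deriv_utility_demand hH s hv, hM.deriv_utility_demand hH s hw] at this
    linarith
  intro w hw
  have himage : (fun v => -M.demand s v) '' Ioi 0 ∈ 𝓝 (-M.demand s w) := by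
    refine mem_of_superset (Iio_mem_nhds (neg_neg_of_pos (hM.demand_pos hH s hw)))
      fun y hy => ?_
    have hy : 0 < -y := neg_pos.2 hy
    exact ⟨_, hM.deriv_utility_pos s hy, by
      simp only [hM.demand_deriv_utility hH s hy, neg_neg]⟩
  have h := continuousAt_of_monotoneOn_of_image_mem_nhds (f := fun v => -M.demand s v)
    hanti.neg (Ioi_mem_nhds hw) himage
  refine (h.neg.congr (Eventually.of_forall fun v => ?_)).continuousWithinAt
  simp

/-- The indirect utility `sup_y (U_s(y) - w y)`. -/
noncomputable def indirectUtility (M : MultipathSystem S J R) (s : S) (w : ℝ) : ℝ :=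
  M.utility s (M.demand s w) - w * M.demand s w

theorem Standing.indirectUtility_lower (hM : M.Standing) (hH : M.AssumptionH) (s : S) {w y : ℝ}
    (hw : 0 < w) (hy : 0 < y) : M.utility s y - w * y ≤ M.indirectUtility s w := by
  by_cases hne : y = M.demand s w
  · rw [hne, indirectUtility]
  · have := hM.utility_lt_tangent s hy (hM.demand_pos hH s hw) hne
    rw [hM.deriv_utility_demand hH s hw] at this
    rw [indirectUtility]
    linarith

theorem Standing.continuousOn_indirectUtility (hM : M.Standing) (hH : M.AssumptionH) (s : S) :
    ContinuousOn (M.indirectUtility s) (Ioi 0) := by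
  have hd := hM.continuousOn_demand hH s
  have hu : ContinuousOn (M.utility s) (Ioi 0) := (hM.utility_contDiff s).continuousOn
  exact (hu.comp hd fun w hw => hM.demand_pos hH s hw).sub (continuousOn_id.mul hd)

end Utility

end MultipathSystem

/-! ### The dual potential, its gradient and strict convexity -/

namespace MultipathSystem

variable {S J R : Type*} {M : MultipathSystem S J R}

/-- The CES weights: `none` stands for the source variable, `some r` for the route `r`. -/
def weight (M : MultipathSystem S J R) : Option R → ℝ
  | none => 1 - M.gamma
  | some _ => M.gamma

/-- The prices `ν_s` and `λ_r - ν_s` of the inputs of the source `s`. -/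
def inputPrice (M : MultipathSystem S J R) (x : PriceState S J) (s : S) : Option R → ℝ
  | none => x.2 s
  | some r => M.routePrice x r - x.2 s

theorem Standing.weight_pos (hM : M.Standing) (i : Option R) : 0 < M.weight i := by
  cases i with
  | none => exact sub_pos.2 hM.gamma_lt_one
  | some r => exact hM.gamma_pos

/-- The pairing of a gradient with a velocity. -/
def pairing [Fintype S] [Fintype J] (g v : PriceState S J) : ℝ :=
  ∑ j, g.1 j * v.1 j + ∑ s, g.2 s * v.2 s

theorem pairing_sub [Fintype S] [Fintype J] (g v w : PriceState S J) :
    pairing g (v - w) = pairing g v - pairing g w := by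
  simp only [pairing, Prod.fst_sub, Prod.snd_sub, Pi.sub_apply, mul_sub, Finset.sum_sub_distrib]
  ring

theorem pairing_smul [Fintype S] [Fintype J] (c : ℝ) (g v : PriceState S J) :
    pairing g (c • v) = c * pairing g v := by
  simp only [pairing, Prod.smul_fst, Prod.smul_snd, Pi.smul_apply, smul_eq_mul, mul_add,
    Finset.mul_sum, mul_left_comm]

theorem continuous_routePrice (r : R) :
    Continuous fun x : PriceState S J => M.routePrice x r := by
  unfold routePrice
  fun_prop

theorem continuous_inputPrice (s : S) (i : Option R) :
    Continuous fun x : PriceState S J => M.inputPrice x s i := by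
  cases i with
  | none => exact (continuous_apply s).comp continuous_snd
  | some r => exact (continuous_routePrice r).sub ((continuous_apply s).comp continuous_snd)

theorem sum_routePrice_mul [Fintype J] [DecidableEq J] [Fintype R] (x : PriceState S J)
    (f : R → ℝ) :
    ∑ r, M.routePrice x r * f r =
      ∑ j, x.1 j * ∑ r ∈ Finset.univ.filter (fun r => j ∈ M.route r), f r := by
  simp only [routePrice, Finset.sum_mul, Finset.mul_sum]
  exact Finset.sum_comm' (by simp)

/-- The route prices are the row vector μA, and full row rank means that the rows of A are linearly
independent, so μ ↦ μA is injective. -/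
theorem FullRowRank.eq_of_routePrice_eq [Fintype J] [DecidableEq J] [Fintype R]
    (hrank : M.FullRowRank) {x x' : PriceState S J}
    (h : ∀ r, M.routePrice x' r = M.routePrice x r) : x'.1 = x.1 := by
  have hli : LinearIndependent ℝ M.routingMatrix.row := by
    rw [linearIndependent_iff_card_eq_finrank_span, ← hrank]
    exact Matrix.rank_eq_finrank_span_row _
  rw [← Matrix.vecMul_injective_iff] at hli
  apply hli
  funext r
  have := h r
  simpa [Matrix.vecMul, dotProduct, routingMatrix, routePrice, Finset.sum_ite_mem] using this

section

variable [Fintype R] [DecidableEq S]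

theorem mem_routesOf {r : R} {s : S} : r ∈ M.routesOf s ↔ M.source r = s := by
  simp [routesOf]

theorem inputPrice_pos {x : PriceState S J} (hx : x ∈ M.stateSpace) (s : S) :
    ∀ i ∈ (M.routesOf s).insertNone, 0 < M.inputPrice x s i := by
  intro i hi
  cases i with
  | none => exact hx.2.1 s
  | some r =>
    rw [Finset.some_mem_insertNone, mem_routesOf] at hi
    subst hi
    exact sub_pos.2 (hx.2.2 r)

theorem sourcePrice_eq (x : PriceState S J) (s : S) :
    M.sourcePrice x s =
      cesPrice (M.routesOf s).insertNone M.p M.weight (M.inputPrice x s) := by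
  rw [sourcePrice, cesPrice, Finset.sum_insertNone, Finset.mul_sum, add_comm]
  rfl

theorem Standing.sourcePrice_pos (hM : M.Standing) {x : PriceState S J} (hx : x ∈ M.stateSpace)
    (s : S) : 0 < M.sourcePrice x s := by
  rw [sourcePrice_eq]
  exact cesPrice.pos ⟨none, Finset.none_mem_insertNone⟩
    (fun i _ => hM.weight_pos i) (inputPrice_pos hx s)

theorem Standing.sourcePrice_le (hM : M.Standing) {x : PriceState S J} (hx : x ∈ M.stateSpace)
    (s : S) {i : Option R} (hi : i ∈ (M.routesOf s).insertNone) :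
    M.sourcePrice x s ≤ M.weight i ^ (M.p / (1 - M.p)) * M.inputPrice x s i := by
  rw [sourcePrice_eq]
  exact cesPrice.le_mul hM.one_lt_p (fun i _ => hM.weight_pos i) (inputPrice_pos hx s) hi

theorem Standing.yBar_pos (hM : M.Standing) (hH : M.AssumptionH) {x : PriceState S J}
    (hx : x ∈ M.stateSpace) (s : S) : 0 < M.yBar x s :=
  hM.demand_pos hH s (hM.sourcePrice_pos hx s)

theorem Standing.deriv_utility_yBar (hM : M.Standing) (hH : M.AssumptionH) {x : PriceState S J}
    (hx : x ∈ M.stateSpace) (s : S) :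
    deriv (M.utility s) (M.yBar x s) = M.sourcePrice x s :=
  hM.deriv_utility_demand hH s (hM.sourcePrice_pos hx s)

theorem Standing.continuousOn_sourcePrice (hM : M.Standing) (s : S) :
    ContinuousOn (fun x => M.sourcePrice x s) M.stateSpace := by
  simp only [sourcePrice_eq]
  unfold cesPrice
  refine ContinuousOn.rpow_const (continuousOn_finsetSum _ fun i hi => ?_) fun x hx =>
    Or.inl (cesPrice.sum_pos ⟨none, Finset.none_mem_insertNone⟩
    (fun i _ => hM.weight_pos i) (inputPrice_pos hx s)).ne'
  exact continuousOn_const.mul ((continuous_inputPrice s i).continuousOn.rpow_const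
    fun x hx => Or.inl (inputPrice_pos hx s i hi).ne')

theorem Standing.continuousOn_yBar (hM : M.Standing) (hH : M.AssumptionH) (s : S) :
    ContinuousOn (fun x => M.yBar x s) M.stateSpace :=
  (hM.continuousOn_demand hH s).comp (hM.continuousOn_sourcePrice s)
    fun _ hx => hM.sourcePrice_pos hx s

theorem Standing.continuousOn_routeRate (hM : M.Standing) (hH : M.AssumptionH) (r : R) :
    ContinuousOn (fun x => M.routeRate x r) M.stateSpace := by
  have hy := hM.continuousOn_yBar hH (M.source r)
  have hd := (hM.continuousOn_deriv_utility (M.source r)).comp hy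
    fun x hx => hM.yBar_pos hH hx (M.source r)
  have hp : 0 ≤ M.p := by linarith [hM.one_lt_p]
  refine hy.mul (ContinuousOn.rpow_const (ContinuousOn.div (continuousOn_const.mul hd) ?_
    fun x hx => (sub_pos.2 (hx.2.2 r)).ne') fun x hx => Or.inr hp)
  exact (continuous_inputPrice (M.source r) (some r)).continuousOn

theorem Standing.continuousOn_sourceRate (hM : M.Standing) (hH : M.AssumptionH) (s : S) :
    ContinuousOn (fun x => M.sourceRate x s) M.stateSpace := by
  have hy := hM.continuousOn_yBar hH s
  have hd := (hM.continuousOn_deriv_utility s).comp hy fun x hx => hM.yBar_pos hH hx s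
  have hp : 0 ≤ M.p := by linarith [hM.one_lt_p]
  refine hy.mul (ContinuousOn.rpow_const (ContinuousOn.div (continuousOn_const.mul hd) ?_
    fun x hx => (hx.2.1 s).ne') fun x hx => Or.inr hp)
  exact (continuous_inputPrice (M := M) s none).continuousOn

/-- The dual potential. -/
noncomputable def potential [Fintype S] [Fintype J] (M : MultipathSystem S J R)
    (x : PriceState S J) : ℝ :=
  ∑ s, M.indirectUtility s (M.sourcePrice x s) + ∑ j, M.capacity j * x.1 j

theorem Standing.continuousOn_potential [Fintype S] [Fintype J] (hM : M.Standing)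
    (hH : M.AssumptionH) : ContinuousOn M.potential M.stateSpace := by
  refine ContinuousOn.add (continuousOn_finsetSum _ fun s _ => ?_) (by fun_prop)
  exact (hM.continuousOn_indirectUtility hH s).comp (hM.continuousOn_sourcePrice s)
    fun x hx => hM.sourcePrice_pos hx s

/-- Two losses add up: the input mix chosen at `x` need not be the cheapest at `x'`, and the output
ȳ_s(x) need not maximize U_s(y) - w y at the price of `x'`. -/
theorem Standing.source_term_le (hM : M.Standing) (hH : M.AssumptionH) {x x' : PriceState S J}
    (hx : x ∈ M.stateSpace) (hx' : x' ∈ M.stateSpace) (s : S) :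
    M.utility s (M.yBar x s) - M.yBar x s * ∑ i ∈ (M.routesOf s).insertNone,
        M.inputPrice x' s i * (M.weight i * M.sourcePrice x s / M.inputPrice x s i) ^ M.p ≤
      M.indirectUtility s (M.sourcePrice x' s) := by
  have h1 := (cesPrice.le_sum_mul_demand hM.one_lt_p ⟨none, Finset.none_mem_insertNone⟩
    (fun i _ => hM.weight_pos i)
    (inputPrice_pos hx s) (inputPrice_pos hx' s)).1
  rw [← sourcePrice_eq, ← sourcePrice_eq] at h1
  have hy := hM.yBar_pos hH hx s
  have h2 := hM.indirectUtility_lower hH s (hM.sourcePrice_pos hx' s) hy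
  have h3 := mul_le_mul_of_nonneg_left h1 hy.le
  linarith

/-- Neither loss may occur. Without an output loss the outputs agree, hence so do their marginal
utilities, which are the aggregates. Without a mix loss the input prices are proportional, and equal
aggregates make the factor 1. -/
theorem Standing.inputPrice_eq_of_source_term_eq (hM : M.Standing) (hH : M.AssumptionH)
    {x x' : PriceState S J} (hx : x ∈ M.stateSpace) (hx' : x' ∈ M.stateSpace) (s : S)
    (h : M.indirectUtility s (M.sourcePrice x' s) ≤
      M.utility s (M.yBar x s) - M.yBar x s * ∑ i ∈ (M.routesOf s).insertNone,
        M.inputPrice x' s i * (M.weight i * M.sourcePrice x s / M.inputPrice x s i) ^ M.p) :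
    ∀ i ∈ (M.routesOf s).insertNone, M.inputPrice x' s i = M.inputPrice x s i := by
  have hg : ∀ i ∈ (M.routesOf s).insertNone, 0 < M.weight i := fun i _ => hM.weight_pos i
  obtain ⟨h1, h1'⟩ := cesPrice.le_sum_mul_demand hM.one_lt_p ⟨none, Finset.none_mem_insertNone⟩ hg
    (inputPrice_pos hx s) (inputPrice_pos hx' s)
  rw [← sourcePrice_eq, ← sourcePrice_eq] at h1 h1'
  have hy := hM.yBar_pos hH hx s
  have hw := hM.sourcePrice_pos hx s
  have hw' := hM.sourcePrice_pos hx' s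
  have h3 := mul_le_mul_of_nonneg_left h1 hy.le
  have hy' : M.yBar x s = M.demand s (M.sourcePrice x' s) := by
    by_contra hne
    have := hM.utility_lt_tangent s hy (hM.demand_pos hH s hw') hne
    rw [hM.deriv_utility_demand hH s hw'] at this
    rw [indirectUtility] at h
    linarith
  have hww : M.sourcePrice x' s = M.sourcePrice x s := by
    rw [← hM.deriv_utility_demand hH s hw', ← hy', hM.deriv_utility_yBar hH hx]
  obtain ⟨c, hc, hcx⟩ := h1' (by
    have h2 := hM.indirectUtility_lower hH s hw' hy
    exact le_of_mul_le_mul_left (by linarith) hy)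
  have h4 := cesPrice.const_mul hM.one_lt_p hc hg (inputPrice_pos hx s) hcx
  rw [← sourcePrice_eq, ← sourcePrice_eq, hww] at h4
  have hc1 : c = 1 := by
    have : (c - 1) * M.sourcePrice x s = 0 := by linarith
    rcases mul_eq_zero.1 this with h | h <;> linarith
  intro i hi
  rw [hcx i hi, hc1, one_mul]

variable [DecidableEq J]

/-- The gradient of the dual potential. -/
noncomputable def gradient (M : MultipathSystem S J R) (x : PriceState S J) : PriceState S J :=
  (fun j => M.capacity j - M.load x j,
   fun s => ∑ r ∈ M.routesOf s, M.routeRate x r - M.sourceRate x s)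

theorem Standing.continuousOn_gradient (hM : M.Standing) (hH : M.AssumptionH) :
    ContinuousOn M.gradient M.stateSpace := by
  refine ContinuousOn.prodMk (continuousOn_pi.2 fun j => ?_) (continuousOn_pi.2 fun s => ?_)
  · exact continuousOn_const.sub
      (continuousOn_finsetSum (Finset.univ.filter fun r => j ∈ M.route r) fun r _ =>
        hM.continuousOn_routeRate hH r)
  · exact (continuousOn_finsetSum _ fun r _ => hM.continuousOn_routeRate hH r).sub
      (hM.continuousOn_sourceRate hH s)

variable [Fintype S] [Fintype J]

/-- The expenditure of the sources at the prices `x'`, with the rates that belong to `x`. -/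
theorem Standing.sum_expenditure (hM : M.Standing) (hH : M.AssumptionH) {x : PriceState S J}
    (hx : x ∈ M.stateSpace) (x' : PriceState S J) :
    ∑ s, M.yBar x s * ∑ i ∈ (M.routesOf s).insertNone, M.inputPrice x' s i *
        (M.weight i * M.sourcePrice x s / M.inputPrice x s i) ^ M.p =
      ∑ j, M.capacity j * x'.1 j - pairing (M.gradient x) x' := by
  have h1 : ∀ s, M.yBar x s * ∑ i ∈ (M.routesOf s).insertNone, M.inputPrice x' s i *
        (M.weight i * M.sourcePrice x s / M.inputPrice x s i) ^ M.p =
      x'.2 s * M.sourceRate x s + ∑ r ∈ M.routesOf s,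
        (M.routePrice x' r * M.routeRate x r - x'.2 s * M.routeRate x r) := by
    intro s
    rw [Finset.sum_insertNone, mul_add, Finset.mul_sum]
    congr 1
    · rw [sourceRate, hM.deriv_utility_yBar hH hx]
      simp only [inputPrice, weight]
      ring
    · refine Finset.sum_congr rfl fun r hr => ?_
      rw [mem_routesOf] at hr
      subst hr
      rw [routeRate, hM.deriv_utility_yBar hH hx]
      simp only [inputPrice, weight]
      ring
  have h2 : ∑ s, ∑ r ∈ M.routesOf s, M.routePrice x' r * M.routeRate x r =
      ∑ j, x'.1 j * M.load x j := by
    simp only [load]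
    rw [← sum_routePrice_mul]
    exact Finset.sum_fiberwise _ M.source _
  -- The terms in ν' collect to minus the ν-part of the pairing; the loads equal the capacities
  -- minus the μ-part of the gradient.
  simp only [h1, Finset.sum_add_distrib, Finset.sum_sub_distrib, h2, pairing, gradient, sub_mul,
    Finset.sum_mul]
  simp only [mul_comm]
  ring

/-- By the cost identity `sum_mul_demand`, the inputs bought at their own prices cost exactly w ȳ,
so the affine minorant x' ↦ ∑ U_s(ȳ_s(x)) + ⟨g(x), x'⟩ touches the potential at x' = x. -/
theorem Standing.potential_eq (hM : M.Standing) (hH : M.AssumptionH) {x : PriceState S J}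
    (hx : x ∈ M.stateSpace) :
    M.potential x = ∑ s, M.utility s (M.yBar x s) + pairing (M.gradient x) x := by
  have h := hM.sum_expenditure hH hx x
  have h2 : ∀ s, ∑ i ∈ (M.routesOf s).insertNone, M.inputPrice x s i *
      (M.weight i * M.sourcePrice x s / M.inputPrice x s i) ^ M.p = M.sourcePrice x s := by
    intro s
    rw [sourcePrice_eq]
    exact cesPrice.sum_mul_demand hM.one_lt_p ⟨none, Finset.none_mem_insertNone⟩
      (fun i _ => hM.weight_pos i)
      (inputPrice_pos hx s)
  simp only [h2] at h
  simp only [potential, indirectUtility, Finset.sum_sub_distrib]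
  simp only [yBar] at h ⊢
  simp only [mul_comm (M.demand _ _)] at h
  linarith

/-- The potential is strictly convex: it lies above its tangent planes. -/
theorem Standing.potential_tangent_le (hM : M.Standing) (hH : M.AssumptionH)
    {x x' : PriceState S J} (hx : x ∈ M.stateSpace) (hx' : x' ∈ M.stateSpace) :
    M.potential x + pairing (M.gradient x) (x' - x) ≤ M.potential x' := by
  have h := hM.sum_expenditure hH hx x'
  have h2 := Finset.sum_le_sum fun s (_ : s ∈ Finset.univ) => hM.source_term_le hH hx hx' s
  rw [Finset.sum_sub_distrib, h] at h2
  rw [hM.potential_eq hH hx, pairing_sub, potential]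
  linarith

/-- Equality of the sums forces equality for every source, so all input prices agree. The prices of
the source variables give ν, the prices of the routes then give λ, and full row rank gives μ. -/
theorem Standing.eq_of_potential_le_tangent (hM : M.Standing) (hrank : M.FullRowRank)
    (hH : M.AssumptionH) {x x' : PriceState S J} (hx : x ∈ M.stateSpace)
    (hx' : x' ∈ M.stateSpace)
    (hle : M.potential x' ≤ M.potential x + pairing (M.gradient x) (x' - x)) : x' = x := by
  have h := hM.sum_expenditure hH hx x'
  have hs := fun s (_ : s ∈ Finset.univ) => hM.source_term_le hH hx hx' s
  have h2 := Finset.sum_le_sum hs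
  have h3 := (Finset.sum_eq_sum_iff_of_le hs).1 (le_antisymm h2 (by
    rw [Finset.sum_sub_distrib, h]
    rw [hM.potential_eq hH hx, pairing_sub, potential] at hle
    linarith))
  have h4 := fun s => hM.inputPrice_eq_of_source_term_eq hH hx hx' s (h3 s (Finset.mem_univ s)).ge
  have hν : x'.2 = x.2 := funext fun s => h4 s none (by simp)
  refine Prod.ext (hrank.eq_of_routePrice_eq fun r => ?_) hν
  have := h4 (M.source r) (some r) (by simp [mem_routesOf])
  simp only [inputPrice, hν] at this
  linarith

end

end MultipathSystem

/-! ### Compactness of the sublevel sets -/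

namespace MultipathSystem

variable {S J R : Type*} {M : MultipathSystem S J R}

/-- The states whose prices are at most `m`, at distance `δ` from the excluded boundary. -/
def stateBox (M : MultipathSystem S J R) (m δ : ℝ) : Set (PriceState S J) :=
  {x | (∀ j, 0 ≤ x.1 j ∧ x.1 j ≤ m) ∧ (∀ s, δ ≤ x.2 s) ∧
    ∀ r, δ ≤ M.routePrice x r - x.2 (M.source r)}

theorem stateBox_subset {m δ : ℝ} (hδ : 0 < δ) : M.stateBox m δ ⊆ M.stateSpace :=
  fun _ hx => ⟨fun j => (hx.1 j).1, fun s => hδ.trans_le (hx.2.1 s),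
    fun r => sub_pos.1 (hδ.trans_le (hx.2.2 r))⟩

theorem isClosed_stateBox (m δ : ℝ) : IsClosed (M.stateBox m δ) := by
  have h1 : ∀ j, Continuous fun x : PriceState S J => x.1 j := fun j => by fun_prop
  have h2 : ∀ s, Continuous fun x : PriceState S J => x.2 s := fun s => by fun_prop
  simp only [stateBox, ofPred_and, ofPred_forall]
  refine IsClosed.inter (isClosed_iInter fun j => IsClosed.inter ?_ ?_)
    (IsClosed.inter (isClosed_iInter fun s => ?_) (isClosed_iInter fun r => ?_))
  · exact isClosed_le continuous_const (h1 j)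
  · exact isClosed_le (h1 j) continuous_const
  · exact isClosed_le continuous_const (h2 s)
  · exact isClosed_le continuous_const ((continuous_routePrice r).sub (h2 _))

theorem routePrice_le_sum [Fintype J] {x : PriceState S J} (hx : ∀ j, 0 ≤ x.1 j) (r : R) :
    M.routePrice x r ≤ ∑ j, x.1 j :=
  Finset.sum_le_sum_of_subset_of_nonneg (Finset.subset_univ _) fun j _ _ => hx j

theorem Standing.isCompact_stateBox [Fintype J] (hM : M.Standing) (m : ℝ) {δ : ℝ} (hδ : 0 < δ) :
    IsCompact (M.stateBox m δ) := by
  refine (isCompact_Icc (a := ((fun _ => 0, fun _ => 0) : PriceState S J))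
    (b := (fun _ => m, fun _ => ∑ _j : J, m))).of_isClosed_subset
    (isClosed_stateBox m δ) fun x hx => ⟨⟨fun j => (hx.1 j).1, fun s => hδ.le.trans (hx.2.1 s)⟩,
      ⟨fun j => (hx.1 j).2, fun s => ?_⟩⟩
  obtain ⟨r, rfl⟩ := hM.source_surjective s
  have h1 := (stateBox_subset hδ hx).2.2 r
  exact h1.le.trans ((routePrice_le_sum (fun j => (hx.1 j).1) r).trans
    (Finset.sum_le_sum fun j _ => (hx.1 j).2))

section

variable [Fintype R] [DecidableEq S] [Fintype J]

/-- The aggregate is at most a constant times the input price ν_s, which lies below the price of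
some route of the source. -/
theorem Standing.sourcePrice_le_sum (hM : M.Standing) :
    ∃ B > 0, ∀ x ∈ M.stateSpace, ∀ s, M.sourcePrice x s ≤ B * ∑ j, x.1 j := by
  have hB := Real.rpow_pos_of_pos (hM.weight_pos none) (M.p / (1 - M.p))
  refine ⟨_, hB, fun x hx s => ?_⟩
  refine (hM.sourcePrice_le hx s Finset.none_mem_insertNone).trans
    (mul_le_mul_of_nonneg_left ?_ hB.le)
  obtain ⟨r, rfl⟩ := hM.source_surjective s
  exact (hx.2.2 r).le.trans (routePrice_le_sum hx.1 r)

variable [Fintype S]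

theorem Standing.potential_coercive (hM : M.Standing) (hH : M.AssumptionH) :
    ∃ k > 0, ∃ C, ∀ x ∈ M.stateSpace, k * ∑ j, x.1 j ≤ M.potential x + C := by
  obtain ⟨B, hB, hle⟩ := hM.sourcePrice_le_sum
  obtain ⟨c, hc, hcle⟩ : ∃ c > 0, ∀ j, c ≤ M.capacity j := by
    rcases isEmpty_or_nonempty J with h | h
    · exact ⟨1, one_pos, fun j => h.elim j⟩
    · obtain ⟨j₀, hj₀⟩ := Finite.exists_min M.capacity
      exact ⟨_, hM.capacity_pos j₀, hj₀⟩
  obtain ⟨n, hn_card⟩ : ∃ n : ℝ, n = (Fintype.card S : ℝ) := ⟨_, rfl⟩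
  have hn : 0 ≤ n := hn_card ▸ Nat.cast_nonneg _
  -- Testing every indirect utility with the output η costs at most n B η ∑ μ_j, where n is the
  -- number of sources. This η is small enough for that to use up only half of the linear term c ∑
  -- μ_j; the 1 avoids division by zero.
  set η : ℝ := c / (2 * (n * B + 1))
  have hη : 0 < η := by positivity
  have hnη : n * (B * η) ≤ c / 2 := by
    have : 0 < n * B + 1 := by positivity
    have h2 : η * (n * B + 1) = c / 2 := by
      simp only [η]
      field_simp
    nlinarith
  refine ⟨c / 2, by positivity, -∑ s, M.utility s η, fun x hx => ?_⟩
  set m := ∑ j, x.1 j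
  have hm : 0 ≤ m := Finset.sum_nonneg fun j _ => hx.1 j
  have h1 : ∑ s, (M.utility s η - B * m * η) ≤ ∑ s, M.indirectUtility s (M.sourcePrice x s) := by
    refine Finset.sum_le_sum fun s _ => ?_
    have h2 := hM.indirectUtility_lower hH s (hM.sourcePrice_pos hx s) hη
    have h3 := mul_le_mul_of_nonneg_right (hle x hx s) hη.le
    linarith
  have h2 : c * m ≤ ∑ j, M.capacity j * x.1 j := by
    rw [Finset.mul_sum]
    exact Finset.sum_le_sum fun j _ => mul_le_mul_of_nonneg_right (hcle j) (hx.1 j)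
  rw [Finset.sum_sub_distrib, Finset.sum_const, nsmul_eq_mul, Finset.card_univ, ← hn_card] at h1
  have h3 := mul_le_mul_of_nonneg_right hnη hm
  have h4 : n * (B * m * η) = n * (B * η) * m := by ring
  rw [h4] at h1
  rw [potential]
  linarith

/-- The sublevel sets of the potential stay away from the excluded boundary and from infinity. -/
theorem Standing.sublevel_subset_compact (hM : M.Standing) (hH : M.AssumptionH) (C : ℝ) :
    ∃ K, IsCompact K ∧ K ⊆ M.stateSpace ∧ ∀ x ∈ M.stateSpace, M.potential x ≤ C → x ∈ K := by
  obtain ⟨B, hB, hle⟩ := hM.sourcePrice_le_sum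
  obtain ⟨k, hk, C₁, hcoer⟩ := hM.potential_coercive hH
  set m := (C + C₁) / k
  have hsum : ∀ x ∈ M.stateSpace, M.potential x ≤ C → ∑ j, x.1 j ≤ m := by
    intro x hx hxC
    rw [le_div_iff₀' hk]
    linarith [hcoer x hx]
  have hlow : ∀ s, ∃ y > 0, ∀ x ∈ M.stateSpace, M.potential x ≤ C → 1 ≤ M.sourcePrice x s * y := by
    intro s
    -- L bounds the indirect utility of s on the sublevel set, since testing with the output 1
    -- bounds the other sources from below. If U_s(y) ≥ L + 1, then U_s(y) - w y ≤ L forces w y ≥ 1,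
    -- so the aggregate cannot approach 0.
    set L := C - ∑ s' ∈ Finset.univ.erase s, (M.utility s' 1 - B * m)
    obtain ⟨y, hyL, hy⟩ := (((hM.utility_tendsto s).eventually_ge_atTop (L + 1)).and
      (eventually_gt_atTop 0)).exists
    refine ⟨y, hy, fun x hx hxC => ?_⟩
    have h1 := hM.indirectUtility_lower hH s (hM.sourcePrice_pos hx s) hy
    have h2 : ∑ s' ∈ Finset.univ.erase s, (M.utility s' 1 - B * m) ≤
        ∑ s' ∈ Finset.univ.erase s, M.indirectUtility s' (M.sourcePrice x s') := by
      refine Finset.sum_le_sum fun s' _ => ?_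
      have h3 := hM.indirectUtility_lower hH s' (hM.sourcePrice_pos hx s') one_pos
      have h4 := (hle x hx s').trans (mul_le_mul_of_nonneg_left (hsum x hx hxC) hB.le)
      linarith
    have h3 : 0 ≤ ∑ j, M.capacity j * x.1 j :=
      Finset.sum_nonneg fun j _ => mul_nonneg (hM.capacity_pos j).le (hx.1 j)
    rw [potential, ← Finset.add_sum_erase _ _ (Finset.mem_univ s)] at hxC
    linarith
  choose y hy hlow using hlow
  -- One bound for all the outputs y_s; the 1 keeps it positive even without sources.
  set D := ∑ s, y s + 1
  have hD : 0 < D := by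
    have := Finset.sum_nonneg fun s (_ : s ∈ Finset.univ) => (hy s).le
    positivity
  set E := M.weight none ^ (M.p / (1 - M.p)) + M.gamma ^ (M.p / (1 - M.p))
  have hE1 := Real.rpow_pos_of_pos (hM.weight_pos none) (M.p / (1 - M.p))
  have hE2 := Real.rpow_pos_of_pos hM.gamma_pos (M.p / (1 - M.p))
  have hE : 0 < E := by positivity
  refine ⟨M.stateBox m (1 / (D * E)), hM.isCompact_stateBox m (by positivity),
    stateBox_subset (by positivity), fun x hx hxC => ?_⟩
  have hin : ∀ s, ∀ i ∈ (M.routesOf s).insertNone, 1 / (D * E) ≤ M.inputPrice x s i := by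
    intro s i hi
    have h1 := hM.sourcePrice_le hx s hi
    have h2 := inputPrice_pos hx s i hi
    have h3 : M.weight i ^ (M.p / (1 - M.p)) ≤ E := by
      cases i with
      | none => exact le_add_of_nonneg_right hE2.le
      | some r => exact le_add_of_nonneg_left hE1.le
    have h4 : y s ≤ D := (Finset.single_le_sum (fun s _ => (hy s).le) (Finset.mem_univ s)).trans
      (by simp [D])
    rw [div_le_iff₀' (by positivity)]
    calc 1 ≤ M.sourcePrice x s * y s := hlow s x hx hxC
      _ ≤ (E * M.inputPrice x s i) * D := by
          gcongr
          · exact (hy s).le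
          · exact h1.trans (by gcongr)
      _ = _ := by ring
  exact ⟨fun j => ⟨hx.1 j, (Finset.single_le_sum (fun j _ => hx.1 j) (Finset.mem_univ j)).trans
    (hsum x hx hxC)⟩, fun s => hin s none Finset.none_mem_insertNone,
    fun r => hin _ (some r) (by simp [mem_routesOf])⟩

end

end MultipathSystem

/-! ### The projected field, its dissipation and the equilibrium -/

theorem posProj_of_pos {b c : ℝ} (hc : 0 < c) : posProj b c = b := if_pos hc

theorem posProj_zero_right (b : ℝ) : posProj b 0 = max 0 b := if_neg (lt_irrefl 0)

theorem mul_posProj (b c : ℝ) : b * posProj b c = posProj b c ^ 2 := by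
  rw [posProj]
  split_ifs
  · ring
  · rcases le_total 0 b with h | h
    · rw [max_eq_right h, sq]
    · rw [max_eq_left h]
      ring

theorem mul_posProj_of_nonneg {a : ℝ} (ha : 0 ≤ a) (b c : ℝ) :
    a * posProj b c = posProj (a * b) c := by
  simp only [posProj]
  split_ifs
  · rfl
  · rw [mul_max_of_nonneg _ _ ha, mul_zero]

theorem abs_posProj_le (b c : ℝ) : |posProj b c| ≤ |b| := by
  rw [posProj]
  split_ifs
  · rfl
  · rw [abs_of_nonneg (le_max_left _ _)]
    exact max_le (abs_nonneg b) (le_abs_self b)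

namespace MultipathSystem

variable {S J R : Type*} {M : MultipathSystem S J R}

/-- The state space is relatively open in the set of states with nonnegative prices. -/
theorem eventually_mem_stateSpace [Finite S] [Finite R] {x : PriceState S J}
    (hx : x ∈ M.stateSpace) : ∀ᶠ y in 𝓝 x, (∀ j, 0 ≤ y.1 j) → y ∈ M.stateSpace := by
  have h1 : ∀ s, ∀ᶠ y : PriceState S J in 𝓝 x, 0 < y.2 s := fun s =>
    (show Continuous fun y : PriceState S J => y.2 s by fun_prop).continuousAt.eventually
      (lt_mem_nhds (hx.2.1 s))
  have h2 : ∀ r, ∀ᶠ y : PriceState S J in 𝓝 x, y.2 (M.source r) < M.routePrice y r := fun r =>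
    (show Continuous fun y : PriceState S J => y.2 (M.source r) by
      fun_prop).continuousAt.eventually_lt (continuous_routePrice r).continuousAt (hx.2.2 r)
  filter_upwards [eventually_all.2 h1, eventually_all.2 h2] with y hy1 hy2 hy
  exact ⟨hy, hy1, hy2⟩

theorem Standing.continuousOn_gainJ (hM : M.Standing) (j : J) :
    ContinuousOn (fun x : PriceState S J => M.gainJ j (x.1 j)) M.stateSpace :=
  (hM.gainJ_cont j).comp (by fun_prop) fun _ hx => hx.1 j

theorem Standing.continuousOn_gainS (hM : M.Standing) (s : S) :
    ContinuousOn (fun x : PriceState S J => M.gainS s (x.2 s)) M.stateSpace :=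
  (hM.gainS_cont s).comp (by fun_prop) fun _ hx => hx.2.1 s

theorem Standing.stateSpace_nonempty (hM : M.Standing) : M.stateSpace.Nonempty := by
  refine ⟨(fun _ => 1, fun _ => 1 / 2), fun _ => zero_le_one, fun _ => by norm_num, fun r => ?_⟩
  have : (1 : ℝ) ≤ (M.route r).card := by exact_mod_cast (hM.route_nonempty r).card_pos
  simp only [routePrice, Finset.sum_const, nsmul_eq_mul, mul_one]
  linarith

section

variable [Fintype S] [Fintype J]

/-- The pairing with a fixed gradient as a continuous linear map. -/
noncomputable def pairingCLM (g : PriceState S J) : PriceState S J →L[ℝ] ℝ :=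
  LinearMap.toContinuousLinearMap
    { toFun := pairing g
      map_add' := fun v w => by
        simp only [pairing, Prod.fst_add, Prod.snd_add, Pi.add_apply, mul_add,
          Finset.sum_add_distrib]
        ring
      map_smul' := fun c v => pairing_smul c g v }

theorem pairingCLM_apply (g v : PriceState S J) : pairingCLM g v = pairing g v := rfl

theorem continuous_pairing_left (v : PriceState S J) :
    Continuous fun g : PriceState S J => pairing g v := by
  unfold pairing
  fun_prop

theorem abs_pairing_le (g v : PriceState S J) :
    |pairing g v| ≤ (Fintype.card J + Fintype.card S) * (‖g‖ * ‖v‖) := by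
  have h1 : ∀ j, |g.1 j * v.1 j| ≤ ‖g‖ * ‖v‖ := fun j => by
    rw [abs_mul]
    exact mul_le_mul ((norm_le_pi_norm g.1 j).trans (norm_fst_le g))
      ((norm_le_pi_norm v.1 j).trans (norm_fst_le v)) (abs_nonneg _) (norm_nonneg _)
  have h2 : ∀ s, |g.2 s * v.2 s| ≤ ‖g‖ * ‖v‖ := fun s => by
    rw [abs_mul]
    exact mul_le_mul ((norm_le_pi_norm g.2 s).trans (norm_snd_le g))
      ((norm_le_pi_norm v.2 s).trans (norm_snd_le v)) (abs_nonneg _) (norm_nonneg _)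
  calc |pairing g v| ≤ |∑ j, g.1 j * v.1 j| + |∑ s, g.2 s * v.2 s| := abs_add_le _ _
    _ ≤ ∑ j, |g.1 j * v.1 j| + ∑ s, |g.2 s * v.2 s| :=
        add_le_add (Finset.abs_sum_le_sum_abs _ _) (Finset.abs_sum_le_sum_abs _ _)
    _ ≤ ∑ _j : J, ‖g‖ * ‖v‖ + ∑ _s : S, ‖g‖ * ‖v‖ :=
        add_le_add (Finset.sum_le_sum fun j _ => h1 j) (Finset.sum_le_sum fun s _ => h2 s)
    _ = _ := by simp [add_mul]

end

section

variable [Fintype R] [DecidableEq S] [DecidableEq J]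

/-- The right-hand side without the projection. -/
noncomputable def drift (M : MultipathSystem S J R) (x : PriceState S J) : PriceState S J :=
  (fun j => M.gainJ j (x.1 j) * (M.load x j - M.capacity j),
   fun s => M.gainS s (x.2 s) * (M.sourceRate x s - ∑ r ∈ M.routesOf s, M.routeRate x r))

/-- A nonnegative gain commutes with the projection. The field is thus the projection of the
continuous `drift`, the form in which solutions are constructed. -/
theorem Standing.field_fst (hM : M.Standing) {x : PriceState S J} {j : J} (hx : 0 ≤ x.1 j) :
    (M.field x).1 j = posProj ((M.drift x).1 j) (x.1 j) :=
  mul_posProj_of_nonneg (hM.gainJ_pos j _ hx).le _ _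

theorem field_snd (x : PriceState S J) : (M.field x).2 = (M.drift x).2 := rfl

theorem Standing.continuousOn_gradient_fst (hM : M.Standing) (hH : M.AssumptionH) (j : J) :
    ContinuousOn (fun x => (M.gradient x).1 j) M.stateSpace :=
  (show Continuous fun y : PriceState S J => y.1 j by fun_prop).comp_continuousOn
    (hM.continuousOn_gradient hH)

theorem Standing.continuousOn_gradient_snd (hM : M.Standing) (hH : M.AssumptionH) (s : S) :
    ContinuousOn (fun x => (M.gradient x).2 s) M.stateSpace :=
  (show Continuous fun y : PriceState S J => y.2 s by fun_prop).comp_continuousOn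
    (hM.continuousOn_gradient hH)

theorem drift_fst (x : PriceState S J) (j : J) :
    (M.drift x).1 j = M.gainJ j (x.1 j) * -(M.gradient x).1 j := by
  simp [drift, gradient]

theorem drift_snd (x : PriceState S J) (s : S) :
    (M.drift x).2 s = M.gainS s (x.2 s) * -(M.gradient x).2 s := by
  simp [drift, gradient]

theorem Standing.continuousOn_drift (hM : M.Standing) (hH : M.AssumptionH) :
    ContinuousOn M.drift M.stateSpace := by
  refine ContinuousOn.prodMk (f := fun x => (M.drift x).1) (g := fun x => (M.drift x).2)
    (continuousOn_pi.2 fun j => ?_) (continuousOn_pi.2 fun s => ?_)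
  · simp only [drift_fst]
    exact (hM.continuousOn_gainJ j).mul (hM.continuousOn_gradient_fst hH j).neg
  · simp only [drift_snd]
    exact (hM.continuousOn_gainS s).mul (hM.continuousOn_gradient_snd hH s).neg

variable [Fintype S] [Fintype J]

/-- By `mul_posProj`, b times its projection is the square of the projection, so the price terms are
squares although the velocity is projected. -/
theorem pairing_gradient_field (x : PriceState S J) :
    pairing (M.gradient x) (M.field x) =
      -(∑ j, M.gainJ j (x.1 j) * posProj (-(M.gradient x).1 j) (x.1 j) ^ 2 +
        ∑ s, M.gainS s (x.2 s) * (M.gradient x).2 s ^ 2) := by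
  simp only [pairing, ← mul_posProj, neg_add, ← Finset.sum_neg_distrib]
  simp only [field, gradient, neg_sub]
  congr 1 <;> refine Finset.sum_congr rfl fun _ _ => ?_ <;> ring

theorem Standing.le_pairing_gradient_field (hM : M.Standing) {x : PriceState S J}
    (hx : x ∈ M.stateSpace) :
    (∀ j, M.gainJ j (x.1 j) * posProj (-(M.gradient x).1 j) (x.1 j) ^ 2 ≤
      -pairing (M.gradient x) (M.field x)) ∧
    (∀ s, M.gainS s (x.2 s) * (M.gradient x).2 s ^ 2 ≤
      -pairing (M.gradient x) (M.field x)) ∧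
    0 ≤ -pairing (M.gradient x) (M.field x) := by
  have h1 : ∀ j ∈ Finset.univ,
      0 ≤ M.gainJ j (x.1 j) * posProj (-(M.gradient x).1 j) (x.1 j) ^ 2 := fun j _ =>
    mul_nonneg (hM.gainJ_pos j _ (hx.1 j)).le (sq_nonneg _)
  have h2 : ∀ s ∈ Finset.univ, 0 ≤ M.gainS s (x.2 s) * (M.gradient x).2 s ^ 2 := fun s _ =>
    mul_nonneg (hM.gainS_pos s _ (hx.2.1 s)).le (sq_nonneg _)
  rw [pairing_gradient_field, neg_neg]
  exact ⟨fun j => (Finset.single_le_sum h1 (Finset.mem_univ j)).trans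
      (le_add_of_nonneg_right (Finset.sum_nonneg h2)),
    fun s => (Finset.single_le_sum h2 (Finset.mem_univ s)).trans
      (le_add_of_nonneg_left (Finset.sum_nonneg h1)),
    add_nonneg (Finset.sum_nonneg h1) (Finset.sum_nonneg h2)⟩

/-- Near a state that is not an equilibrium the potential is dissipated at a positive rate. -/
theorem Standing.eventually_dissipation (hM : M.Standing) (hH : M.AssumptionH)
    {x : PriceState S J} (hx : x ∈ M.stateSpace) (hF : M.field x ≠ 0) :
    ∃ m > 0, ∀ᶠ y in 𝓝[M.stateSpace] x, m ≤ -pairing (M.gradient y) (M.field y) := by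
  by_cases hs : ∃ s, (M.gradient x).2 s ≠ 0
  · obtain ⟨s, hs⟩ := hs
    have hpos : 0 < M.gainS s (x.2 s) * (M.gradient x).2 s ^ 2 :=
      mul_pos (hM.gainS_pos s _ (hx.2.1 s)) (by positivity)
    have hc := ((hM.continuousOn_gainS s).mul ((hM.continuousOn_gradient_snd hH s).pow 2)) x hx
    refine ⟨_, half_pos hpos, ?_⟩
    filter_upwards [hc.eventually (lt_mem_nhds (half_lt_self hpos)), self_mem_nhdsWithin]
      with y hy hyΩ
    exact hy.le.trans ((hM.le_pairing_gradient_field hyΩ).2.1 s)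
  · push Not at hs
    obtain ⟨j, hj⟩ : ∃ j, posProj (-(M.gradient x).1 j) (x.1 j) ≠ 0 := by
      by_contra! h
      refine hF (Prod.ext (funext fun j => ?_) (funext fun s => ?_))
      · have := h j
        simp only [gradient, neg_sub] at this
        simp [field, this]
      · have := drift_snd (M := M) x s
        rw [hs s, neg_zero, mul_zero] at this
        rw [field_snd, this]
        rfl
    have hcg := (hM.continuousOn_gradient_fst hH j).neg x hx
    -- The projection is inactive near `x` in this coordinate: either the price is positive nearby,
    -- or the price is 0 at `x` and the excess load is positive nearby, where both branches of the
    -- projection return it.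
    obtain ⟨hne, hev⟩ : -(M.gradient x).1 j ≠ 0 ∧ ∀ᶠ y in 𝓝[M.stateSpace] x,
        posProj (-(M.gradient y).1 j) (y.1 j) = -(M.gradient y).1 j := by
      rcases (hx.1 j).eq_or_lt with h0 | h0
      · rw [← h0, posProj_zero_right] at hj
        have hb : 0 < -(M.gradient x).1 j := by
          by_contra! hle
          exact hj (max_eq_left hle)
        refine ⟨hb.ne', ?_⟩
        filter_upwards [hcg.eventually (lt_mem_nhds hb)] with y hy
        rw [posProj]
        split_ifs
        · rfl
        · exact max_eq_right (le_of_lt hy)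
      · rw [posProj_of_pos h0] at hj
        refine ⟨hj, ?_⟩
        have hc : Continuous fun y : PriceState S J => y.1 j := by fun_prop
        filter_upwards [hc.continuousWithinAt.eventually (lt_mem_nhds h0)] with y hy
        exact posProj_of_pos hy
    have hpos : 0 < M.gainJ j (x.1 j) * (-(M.gradient x).1 j) ^ 2 :=
      mul_pos (hM.gainJ_pos j _ (hx.1 j)) (by positivity)
    have hc := ((hM.continuousOn_gainJ j).mul ((hM.continuousOn_gradient_fst hH j).neg.pow 2)) x hx
    refine ⟨_, half_pos hpos, ?_⟩
    filter_upwards [hc.eventually (lt_mem_nhds (half_lt_self hpos)), self_mem_nhdsWithin, hev]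
      with y hy hyΩ hye
    have := (hM.le_pairing_gradient_field hyΩ).1 j
    rw [hye] at this
    exact (le_of_lt hy).trans this

theorem Standing.exists_dissipation_bound (hM : M.Standing) (hH : M.AssumptionH)
    {K : Set (PriceState S J)} (hK : IsCompact K) (hKΩ : K ⊆ M.stateSpace)
    (hF : ∀ x ∈ K, M.field x ≠ 0) :
    ∃ m > 0, ∀ x ∈ K, m ≤ -pairing (M.gradient x) (M.field x) := by
  refine hK.induction_on (p := fun s => ∃ m > 0, ∀ x ∈ s, m ≤ -pairing (M.gradient x) (M.field x))
    ⟨1, one_pos, fun _ h => h.elim⟩ ?_ ?_ ?_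
  · rintro s t hst ⟨m, hm, h⟩
    exact ⟨m, hm, fun x hx => h x (hst hx)⟩
  · rintro s t ⟨m, hm, h⟩ ⟨m', hm', h'⟩
    refine ⟨min m m', lt_min hm hm', fun x hx => ?_⟩
    rcases hx with hx | hx
    · exact (min_le_left _ _).trans (h x hx)
    · exact (min_le_right _ _).trans (h' x hx)
  · intro x hx
    obtain ⟨m, hm, h⟩ := hM.eventually_dissipation hH (hKΩ hx) (hF x hx)
    exact ⟨_, nhdsWithin_mono x hKΩ h, m, hm, fun y hy => hy⟩

/-- A vanishing field has zero dissipation, so each of its squares vanishes: the gradient is 0 in ν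
and wherever the price is positive, and nonnegative where the price is 0. This is the first-order
optimality condition. -/
theorem Standing.pairing_nonneg_of_isEquilibrium (hM : M.Standing) {e x : PriceState S J}
    (he : M.IsEquilibrium e) (hx : x ∈ M.stateSpace) :
    0 ≤ pairing (M.gradient e) (x - e) := by
  obtain ⟨heΩ, hF⟩ := he
  have hW : pairing (M.gradient e) (M.field e) = 0 := by simp [hF, pairing]
  obtain ⟨h1, h2, -⟩ := hM.le_pairing_gradient_field heΩ
  rw [hW, neg_zero] at h1 h2
  refine add_nonneg (Finset.sum_nonneg fun j _ => ?_) (Finset.sum_nonneg fun s _ => ?_)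
  · have hj : posProj (-(M.gradient e).1 j) (e.1 j) = 0 := by
      have h3 := hM.gainJ_pos j _ (heΩ.1 j)
      have h4 := h1 j
      by_contra hne
      have : 0 < M.gainJ j (e.1 j) * posProj (-(M.gradient e).1 j) (e.1 j) ^ 2 := by positivity
      linarith
    rcases (heΩ.1 j).eq_or_lt with h0 | h0
    · rw [← h0, posProj_zero_right] at hj
      have h3 := le_max_right 0 (-(M.gradient e).1 j)
      have h4 := hx.1 j
      rw [hj] at h3
      refine mul_nonneg (by linarith) ?_
      simp only [Prod.fst_sub, Pi.sub_apply]
      linarith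
    · rw [posProj_of_pos h0] at hj
      rw [neg_eq_zero.1 hj, zero_mul]
  · have hs : (M.gradient e).2 s = 0 := by
      have h3 := hM.gainS_pos s _ (heΩ.2.1 s)
      have h4 := h2 s
      by_contra hne
      have : 0 < M.gainS s (e.2 s) * (M.gradient e).2 s ^ 2 := by positivity
      linarith
    rw [hs, zero_mul]

/-- An equilibrium is the only minimum point of the potential. -/
theorem Standing.eq_of_potential_le (hM : M.Standing) (hrank : M.FullRowRank)
    (hH : M.AssumptionH) {e x : PriceState S J} (he : M.IsEquilibrium e) (hx : x ∈ M.stateSpace)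
    (hle : M.potential x ≤ M.potential e) : x = e :=
  hM.eq_of_potential_le_tangent hrank hH he.1 hx
    (hle.trans (le_add_of_nonneg_right (hM.pairing_nonneg_of_isEquilibrium he hx)))

/-- At a zero price the projected velocity is nonnegative, and the other constraints are open, so
the field is a feasible direction. -/
theorem Standing.eventually_add_smul_field_mem (hM : M.Standing) {x : PriceState S J}
    (hx : x ∈ M.stateSpace) : ∀ᶠ h in 𝓝[>] (0 : ℝ), x + h • M.field x ∈ M.stateSpace := by
  have hc : Continuous fun h : ℝ => x + h • M.field x := by fun_prop
  have ht : Tendsto (fun h : ℝ => x + h • M.field x) (𝓝[>] 0) (𝓝 x) :=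
    (hc.tendsto' 0 x (by simp)).mono_left nhdsWithin_le_nhds
  have hj : ∀ j, ∀ᶠ h in 𝓝[>] (0 : ℝ), 0 ≤ (x + h • M.field x).1 j := by
    intro j
    rcases (hx.1 j).eq_or_lt with h0 | h0
    · have hF : 0 ≤ (M.field x).1 j := by
        rw [hM.field_fst (hx.1 j), ← h0, posProj_zero_right]
        exact le_max_left _ _
      filter_upwards [self_mem_nhdsWithin] with h hh
      simp only [Prod.fst_add, Prod.smul_fst, Pi.add_apply, Pi.smul_apply, smul_eq_mul, ← h0]
      have := mul_nonneg (le_of_lt hh) hF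
      linarith
    · have hc' : Continuous fun y : PriceState S J => y.1 j := by fun_prop
      filter_upwards [((hc'.tendsto x).comp ht).eventually (lt_mem_nhds h0)] with h hh
      exact le_of_lt hh
  filter_upwards [ht.eventually (eventually_mem_stateSpace hx), eventually_all.2 hj]
    with h h1 h2
  exact h1 h2

/-- At a minimizer with nonzero field the dissipation is positive, so a short step along the field
would lower the potential. -/
theorem Standing.exists_isEquilibrium (hM : M.Standing) (hH : M.AssumptionH) :
    ∃ e, M.IsEquilibrium e := by
  obtain ⟨x₀, hx₀⟩ := hM.stateSpace_nonempty
  obtain ⟨K, hK, hKΩ, hsub⟩ := hM.sublevel_subset_compact hH (M.potential x₀)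
  have hx₀K := hsub x₀ hx₀ le_rfl
  obtain ⟨e, heK, hmin⟩ := hK.exists_isMinOn ⟨x₀, hx₀K⟩ ((hM.continuousOn_potential hH).mono hKΩ)
  have heΩ := hKΩ heK
  have hmin' : ∀ x ∈ M.stateSpace, M.potential e ≤ M.potential x := by
    intro x hx
    by_contra! hlt
    have h1 := hmin hx₀K
    have h2 := hmin (hsub x hx (hlt.le.trans h1))
    simp only [mem_ofPred_eq] at h2
    linarith
  refine ⟨e, heΩ, ?_⟩
  by_contra hF
  obtain ⟨m, hm, hev⟩ := hM.eventually_dissipation hH heΩ hF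
  have hneg := hev.self_of_nhdsWithin heΩ
  have hmem := hM.eventually_add_smul_field_mem heΩ
  have ht : Tendsto (fun h : ℝ => e + h • M.field e) (𝓝[>] 0) (𝓝[M.stateSpace] e) := by
    have hc : Continuous fun h : ℝ => e + h • M.field e := by fun_prop
    exact tendsto_nhdsWithin_iff.2
      ⟨(hc.tendsto' 0 e (by simp)).mono_left nhdsWithin_le_nhds, hmem⟩
  have hG : Tendsto (fun h : ℝ => pairing (M.gradient (e + h • M.field e)) (M.field e)) (𝓝[>] 0)
      (𝓝 (pairing (M.gradient e) (M.field e))) :=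
    ((continuous_pairing_left _).tendsto _).comp
      ((hM.continuousOn_gradient hH e heΩ).tendsto.comp ht)
  obtain ⟨h, ⟨hGh, hh⟩, hhΩ⟩ := (((hG.eventually (gt_mem_nhds (show
    pairing (M.gradient e) (M.field e) < 0 by linarith))).and self_mem_nhdsWithin).and hmem).exists
  -- The tangent plane is taken at the displaced point and evaluated at `e`. By continuity of the
  -- gradient its slope along the field is still negative, which gives V(e + hF) < V(e) without
  -- differentiating V.
  have h1 := hM.potential_tangent_le hH hhΩ heΩ
  have h2 := hmin' _ hhΩ
  have h3 : e - (e + h • M.field e) = (-h) • M.field e := by simp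
  rw [h3, pairing_smul] at h1
  have hh : 0 < h := hh
  nlinarith

end

end MultipathSystem

/-! ### Decay of the potential, stability and attraction -/

/-- Induction on the number of pieces of length δ/2, half of δ because the hypothesis asks for
strictly less than δ. -/
theorem antitoneOn_Icc_of_locally {f : ℝ → ℝ} {T δ : ℝ} (hδ : 0 < δ)
    (h : ∀ s t, 0 ≤ s → s ≤ t → t ≤ T → t - s < δ → f t ≤ f s) : AntitoneOn f (Icc 0 T) := by
  have key : ∀ n : ℕ, ∀ s t, 0 ≤ s → s ≤ t → t ≤ T → t - s ≤ n * (δ / 2) → f t ≤ f s := by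
    intro n
    induction n with
    | zero =>
      intro s t h0 hst htT hn
      have : s = t := le_antisymm hst (by simpa using hn)
      rw [this]
    | succ n ih =>
      intro s t h0 hst htT hn
      push_cast at hn
      have h1 : max s (t - δ / 2) ≤ t := max_le hst (by linarith)
      refine (h (max s (t - δ / 2)) t (h0.trans (le_max_left _ _)) h1 htT ?_).trans
        (ih s _ h0 (le_max_left _ _) (h1.trans htT) ?_)
      · linarith [le_max_right s (t - δ / 2)]
      · rcases le_total s (t - δ / 2) with h2 | h2
        · rw [max_eq_right h2]
          linarith
        · rw [max_eq_left h2, sub_self]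
          positivity
  intro s hs t ht hst
  obtain ⟨n, hn⟩ := exists_nat_ge ((t - s) / (δ / 2))
  exact key n s t hs.1 hst ht.2 (by rwa [div_le_iff₀ (by positivity)] at hn)

namespace MultipathSystem

variable {S J R : Type*} {M : MultipathSystem S J R}
theorem intervalIntegrable_pairing [Fintype S] [Fintype J] {g f : ℝ → PriceState S J}
    {s t : ℝ} (hst : s ≤ t) (hg : ContinuousOn g (Icc s t))
    (hf : IntervalIntegrable f volume s t) :
    IntervalIntegrable (fun τ => pairing (g τ) (f τ)) volume s t := by
  rw [← uIcc_of_le hst] at hg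
  have h1 : ∀ j, IntervalIntegrable (fun τ => (f τ).1 j) volume s t := fun j =>
    let L := (ContinuousLinearMap.proj (R := ℝ) (φ := fun _ : J => ℝ) j).comp
      (ContinuousLinearMap.fst ℝ (J → ℝ) (S → ℝ))
    ⟨L.integrable_comp hf.1, L.integrable_comp hf.2⟩
  have h2 : ∀ i, IntervalIntegrable (fun τ => (f τ).2 i) volume s t := fun i =>
    let L := (ContinuousLinearMap.proj (R := ℝ) (φ := fun _ : S => ℝ) i).comp
      (ContinuousLinearMap.snd ℝ (J → ℝ) (S → ℝ))
    ⟨L.integrable_comp hf.1, L.integrable_comp hf.2⟩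
  refine IntervalIntegrable.add ?_ ?_
  · have h3 := IntervalIntegrable.sum Finset.univ fun j (_ : j ∈ Finset.univ) =>
      (h1 j).continuousOn_mul (g := fun τ => (g τ).1 j)
        ((show Continuous fun y : PriceState S J => y.1 j by fun_prop).comp_continuousOn hg)
    simpa only [Finset.sum_fn] using h3
  · have h3 := IntervalIntegrable.sum Finset.univ fun i (_ : i ∈ Finset.univ) =>
      (h2 i).continuousOn_mul (g := fun τ => (g τ).2 i)
        ((show Continuous fun y : PriceState S J => y.2 i by fun_prop).comp_continuousOn hg)
    simpa only [Finset.sum_fn] using h3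

variable [Fintype R] [DecidableEq S] [DecidableEq J] [Fintype S] [Fintype J]

namespace IsSolutionOn

variable {X : ℝ → PriceState S J} {T : ℝ}

theorem mono {I I' : Set ℝ} (h : M.IsSolutionOn I X) (hI : I' ⊆ I) : M.IsSolutionOn I' X :=
  fun t ht => h t (hI ht)

theorem continuousOn (h : M.IsSolutionOn (Icc 0 T) X) (hT : 0 ≤ T) :
    ContinuousOn X (Icc 0 T) := by
  have hint := (h T (right_mem_Icc.2 hT)).2.1
  have hc := intervalIntegral.continuousOn_primitive_interval
    (f := fun τ => M.field (X τ)) (μ := volume) (a := 0) (b := T) (by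
      rw [uIcc_of_le hT]
      exact (intervalIntegrable_iff_integrableOn_Icc_of_le hT).1 hint)
  rw [uIcc_of_le hT] at hc
  exact (continuousOn_const.add hc).congr fun t ht => (h t ht).2.2

theorem intervalIntegrable (h : M.IsSolutionOn (Icc 0 T) X) {s t : ℝ} (hs : 0 ≤ s) (hst : s ≤ t)
    (ht : t ≤ T) : IntervalIntegrable (fun τ => M.field (X τ)) volume s t :=
  (h t ⟨hs.trans hst, ht⟩).2.1.mono_set (by
    rw [uIcc_of_le hst, uIcc_of_le (hs.trans hst)]
    exact Icc_subset_Icc_left hs)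

theorem sub_eq (h : M.IsSolutionOn (Icc 0 T) X) {s t : ℝ} (hs : 0 ≤ s) (hst : s ≤ t)
    (ht : t ≤ T) : X t - X s = ∫ τ in s..t, M.field (X τ) := by
  rw [(h t ⟨hs.trans hst, ht⟩).2.2, (h s ⟨hs, hst.trans ht⟩).2.2, add_sub_add_left_eq_sub,
    intervalIntegral.integral_interval_sub_left (h t ⟨hs.trans hst, ht⟩).2.1
      (h s ⟨hs, hst.trans ht⟩).2.1]

end IsSolutionOn

/-- The potential decreases along a solution at least by the integrated dissipation. -/
theorem Standing.potential_sub_le (hM : M.Standing) (hH : M.AssumptionH)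
    {X : ℝ → PriceState S J} {T : ℝ} (hX : M.IsSolutionOn (Icc 0 T) X) {s t : ℝ} (hs : 0 ≤ s)
    (hst : s ≤ t) (ht : t ≤ T) :
    M.potential (X t) - M.potential (X s) ≤
      ∫ τ in s..t, pairing (M.gradient (X τ)) (M.field (X τ)) := by
  have hT : 0 ≤ T := hs.trans (hst.trans ht)
  have hXΩ : MapsTo X (Icc 0 T) M.stateSpace := fun τ hτ => (hX τ hτ).1
  have hG : ContinuousOn (fun τ => M.gradient (X τ)) (Icc 0 T) :=
    (hM.continuousOn_gradient hH).comp (hX.continuousOn hT) hXΩ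
  have hGu := isCompact_Icc.uniformContinuousOn_of_continuous hG
  have hW : ∀ {a b : ℝ}, 0 ≤ a → a ≤ b → b ≤ T →
      IntervalIntegrable (fun τ => pairing (M.gradient (X τ)) (M.field (X τ))) volume a b :=
    fun ha hab hb => intervalIntegrable_pairing hab (hG.mono (Icc_subset_Icc ha hb))
      (hX.intervalIntegrable ha hab hb)
  set N : ℝ := (Fintype.card J : ℝ) + Fintype.card S
  have hN : 0 ≤ N := by positivity
  have key : ∀ ε > 0, M.potential (X t) - M.potential (X s) ≤
      ∫ τ in s..t, (pairing (M.gradient (X τ)) (M.field (X τ)) + N * ε * ‖M.field (X τ)‖) := by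
    intro ε hε
    obtain ⟨δ, hδ, hδε⟩ := Metric.uniformContinuousOn_iff.1 hGu ε hε
    set w : ℝ → ℝ := fun τ =>
      pairing (M.gradient (X τ)) (M.field (X τ)) + N * ε * ‖M.field (X τ)‖
    have hw : ∀ {a b : ℝ}, 0 ≤ a → a ≤ b → b ≤ T → IntervalIntegrable w volume a b :=
      fun ha hab hb => (hW ha hab hb).add ((hX.intervalIntegrable ha hab hb).norm.const_mul _)
    have hanti : AntitoneOn (fun t => M.potential (X t) - ∫ τ in (0 : ℝ)..t, w τ) (Icc 0 T) := by
      refine antitoneOn_Icc_of_locally hδ fun a b ha hab hb hlt => ?_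
      have hb' : b ∈ Icc 0 T := ⟨ha.trans hab, hb⟩
      have ha' : a ∈ Icc 0 T := ⟨ha, hab.trans hb⟩
      -- The tangent inequality at the right end b bounds V(X b) - V(X a) by the integral of ⟨g(X
      -- b), F⟩. On an interval shorter than δ, replacing g(X b) by g(X τ) costs at most N ε ‖F‖,
      -- the extra term in `w`.
      have h1 := hM.potential_tangent_le hH (hXΩ hb') (hXΩ ha')
      rw [pairing_sub] at h1
      have h2 : pairing (M.gradient (X b)) (X b) - pairing (M.gradient (X b)) (X a) =
          ∫ τ in a..b, pairing (M.gradient (X b)) (M.field (X τ)) := by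
        rw [← pairing_sub, hX.sub_eq ha hab hb, ← pairingCLM_apply,
          ← ContinuousLinearMap.intervalIntegral_comp_comm _ (hX.intervalIntegrable ha hab hb)]
        rfl
      have h3 : ∫ τ in a..b, pairing (M.gradient (X b)) (M.field (X τ)) ≤ ∫ τ in a..b, w τ := by
        refine intervalIntegral.integral_mono_on hab (intervalIntegrable_pairing hab
          continuousOn_const (hX.intervalIntegrable ha hab hb)) (hw ha hab hb) fun τ hτ => ?_
        have hτ' : τ ∈ Icc 0 T := ⟨ha.trans hτ.1, hτ.2.trans hb⟩
        have h4 := hδε b hb' τ hτ' (by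
          rw [Real.dist_eq, abs_of_nonneg (by linarith [hτ.2])]
          linarith [hτ.1])
        rw [dist_eq_norm] at h4
        have h5 := abs_pairing_le (M.gradient (X b) - M.gradient (X τ)) (M.field (X τ))
        have h6 : pairing (M.gradient (X b) - M.gradient (X τ)) (M.field (X τ)) =
            pairing (M.gradient (X b)) (M.field (X τ)) -
              pairing (M.gradient (X τ)) (M.field (X τ)) := by
          simp only [pairing, Prod.fst_sub, Prod.snd_sub, Pi.sub_apply, sub_mul,
            Finset.sum_sub_distrib]
          ring
        have h7 : N * (‖M.gradient (X b) - M.gradient (X τ)‖ * ‖M.field (X τ)‖) ≤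
            N * (ε * ‖M.field (X τ)‖) := by gcongr
        have h8 := (le_abs_self _).trans (h5.trans h7)
        rw [h6] at h8
        simp only [w]
        linarith
      have h9 := intervalIntegral.integral_interval_sub_left (hw le_rfl hb'.1 hb)
        (hw le_rfl ha (hab.trans hb))
      linarith
    have h := hanti ⟨hs, hst.trans ht⟩ ⟨hs.trans hst, ht⟩ hst
    have h9 := intervalIntegral.integral_interval_sub_left (hw le_rfl (hs.trans hst) ht)
        (hw le_rfl hs (hst.trans ht))
    simp only at h
    linarith
  refine le_of_forall_pos_le_add fun η hη => ?_
  set Φ := ∫ τ in s..t, ‖M.field (X τ)‖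
  have hΦ : 0 ≤ Φ := intervalIntegral.integral_nonneg hst fun τ _ => norm_nonneg _
  -- This ε makes the error N ε Φ at most η; the 1 covers N Φ = 0.
  have h := key (η / (N * Φ + 1)) (by positivity)
  rw [intervalIntegral.integral_add (hW hs hst ht)
    ((hX.intervalIntegrable hs hst ht).norm.const_mul _), intervalIntegral.integral_const_mul] at h
  refine h.trans (add_le_add_right ?_ _)
  have : N * (η / (N * Φ + 1)) * Φ = η * ((N * Φ) / (N * Φ + 1)) := by ring
  rw [this]
  exact mul_le_of_le_one_right hη.le ((div_le_one (by positivity)).2 (by linarith))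

theorem Standing.potential_antitone (hM : M.Standing) (hH : M.AssumptionH)
    {X : ℝ → PriceState S J} {T : ℝ} (hX : M.IsSolutionOn (Icc 0 T) X) :
    AntitoneOn (fun t => M.potential (X t)) (Icc 0 T) := by
  intro s hs t ht hst
  have h1 := hM.potential_sub_le hH hX hs.1 hst ht.2
  have h2 : ∫ τ in s..t, pairing (M.gradient (X τ)) (M.field (X τ)) ≤ 0 := by
    rw [← neg_nonneg, ← intervalIntegral.integral_neg]
    exact intervalIntegral.integral_nonneg hst fun τ hτ =>
      (hM.le_pairing_gradient_field (hX τ ⟨hs.1.trans hτ.1, hτ.2.trans ht.2⟩).1).2.2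
  simp only
  linarith

/-- States of nearly minimal potential are near the equilibrium. -/
theorem Standing.exists_potential_gap (hM : M.Standing) (hrank : M.FullRowRank)
    (hH : M.AssumptionH) {e : PriceState S J} (he : M.IsEquilibrium e) {ε : ℝ} (hε : 0 < ε) :
    ∃ η > 0, ∀ x ∈ M.stateSpace, M.potential x < M.potential e + η → dist x e < ε := by
  obtain ⟨K, hK, hKΩ, hsub⟩ := hM.sublevel_subset_compact hH (M.potential e + 1)
  have hK' : IsCompact (K \ Metric.ball e ε) := hK.diff Metric.isOpen_ball
  rcases (K \ Metric.ball e ε).eq_empty_or_nonempty with hemp | hne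
  · refine ⟨1, one_pos, fun x hx hlt => ?_⟩
    by_contra hd
    exact eq_empty_iff_forall_notMem.1 hemp x ⟨hsub x hx hlt.le, hd⟩
  · obtain ⟨z, hz, hmin⟩ := hK'.exists_isMinOn hne
      ((hM.continuousOn_potential hH).mono (sdiff_subset.trans hKΩ))
    have hze : M.potential e < M.potential z := by
      by_contra! hle
      have := hM.eq_of_potential_le hrank hH he (hKΩ hz.1) hle
      exact hz.2 (by simpa [this] using hε)
    -- The cap 1 keeps the points considered inside `K`; the other bound is the excess of the
    -- potential on `K` outside the ball.
    refine ⟨min 1 (M.potential z - M.potential e), lt_min one_pos (sub_pos.2 hze),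
      fun x hx hlt => ?_⟩
    by_contra hd
    have h1 := hmin (show x ∈ K \ Metric.ball e ε from
      ⟨hsub x hx (hlt.le.trans (by gcongr; exact min_le_left _ _)), hd⟩)
    have h2 := min_le_right 1 (M.potential z - M.potential e)
    simp only [mem_ofPred_eq] at h1
    linarith

theorem Standing.stable (hM : M.Standing) (hrank : M.FullRowRank) (hH : M.AssumptionH)
    {e : PriceState S J} (he : M.IsEquilibrium e) {ε : ℝ} (hε : 0 < ε) :
    ∃ δ > 0, ∀ T > 0, ∀ X : ℝ → PriceState S J, M.IsSolutionOn (Ico 0 T) X → dist (X 0) e < δ →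
      ∀ t ∈ Ico 0 T, dist (X t) e < ε := by
  obtain ⟨η, hη, hgap⟩ := hM.exists_potential_gap hrank hH he hε
  have hc := (hM.continuousOn_potential hH) e he.1
  obtain ⟨δ, hδ, hδη⟩ := Metric.mem_nhdsWithin_iff.1
    (hc.eventually (gt_mem_nhds (show M.potential e < M.potential e + η by linarith)))
  refine ⟨δ, hδ, fun T hT X hX hd t ht => ?_⟩
  have hX' : M.IsSolutionOn (Icc 0 t) X := hX.mono fun τ hτ => ⟨hτ.1, hτ.2.trans_lt ht.2⟩
  have h0 : M.potential (X 0) < M.potential e + η := hδη ⟨hd, (hX 0 ⟨le_rfl, hT⟩).1⟩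
  exact hgap _ (hX t ht).1 ((hM.potential_antitone hH hX' ⟨le_rfl, ht.1⟩ ⟨ht.1, le_rfl⟩
    ht.1).trans_lt h0)

/-- If V stayed at least η above its minimum, the solution would remain in a compact set without
equilibria, where V falls at a rate at least m > 0, and V would drop below its minimum. -/
theorem Standing.attractive (hM : M.Standing) (hrank : M.FullRowRank) (hH : M.AssumptionH)
    {e : PriceState S J} (he : M.IsEquilibrium e) {X : ℝ → PriceState S J}
    (hX : M.IsSolutionOn (Ici 0) X) : Tendsto X atTop (𝓝 e) := by
  rw [Metric.tendsto_atTop]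
  intro ε hε
  obtain ⟨η, hη, hgap⟩ := hM.exists_potential_gap hrank hH he hε
  have hXT : ∀ T, M.IsSolutionOn (Icc 0 T) X := fun T => hX.mono fun τ hτ => hτ.1
  suffices h : ∃ t₀, 0 ≤ t₀ ∧ M.potential (X t₀) < M.potential e + η by
    obtain ⟨t₀, ht₀, hlt⟩ := h
    exact ⟨t₀, fun t ht => hgap _ (hX t (ht₀.trans ht)).1 ((hM.potential_antitone hH (hXT t)
      ⟨ht₀, ht⟩ ⟨ht₀.trans ht, le_rfl⟩ ht).trans_lt hlt)⟩
  by_contra! hge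
  obtain ⟨K, hK, hKΩ, hsub⟩ := hM.sublevel_subset_compact hH (M.potential (X 0))
  have hc := (hM.continuousOn_potential hH).mono hKΩ
  set K' := K ∩ M.potential ⁻¹' Ici (M.potential e + η)
  have hK' : IsCompact K' := hK.of_isClosed_subset
    (hc.preimage_isClosed_of_isClosed hK.isClosed isClosed_Ici) inter_subset_left
  obtain ⟨m, hm, hW⟩ := hM.exists_dissipation_bound hH hK' (inter_subset_left.trans hKΩ) (by
    rintro x ⟨hxK, hx⟩ hF
    have hxe := hM.eq_of_potential_le hrank hH ⟨hKΩ hxK, hF⟩ he.1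
    have h1 : M.potential e + η ≤ M.potential x := hx
    have := hxe (by linarith)
    rw [← this] at h1
    linarith)
  have hmem : ∀ t, 0 ≤ t → X t ∈ K' := fun t ht =>
    ⟨hsub _ (hX t ht).1 (hM.potential_antitone hH (hXT t) ⟨le_rfl, ht⟩ ⟨ht, le_rfl⟩ ht), hge t ht⟩
  obtain ⟨t, ht⟩ := exists_gt (max 0 ((M.potential (X 0) - M.potential e) / m))
  have ht0 : 0 ≤ t := (le_max_left _ _).trans ht.le
  have ht1 := (le_max_right _ _).trans_lt ht
  rw [div_lt_iff₀ hm] at ht1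
  have h1 := hM.potential_sub_le hH (hXT t) le_rfl ht0 le_rfl
  have h2 : ∫ τ in (0 : ℝ)..t, pairing (M.gradient (X τ)) (M.field (X τ)) ≤
      ∫ _τ in (0 : ℝ)..t, -m := by
    refine intervalIntegral.integral_mono_on ht0 (intervalIntegrable_pairing ht0 ?_
      ((hXT t).intervalIntegrable le_rfl ht0 le_rfl)) intervalIntegrable_const fun τ hτ => ?_
    · exact (hM.continuousOn_gradient hH).comp ((hXT t).continuousOn ht0) fun τ hτ => (hX τ hτ.1).1
    · linarith [hW _ (hmem τ hτ.1)]
  rw [intervalIntegral.integral_const, smul_eq_mul, sub_zero] at h2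
  have h3 := hge t ht0
  nlinarith

end MultipathSystem

/-! ### Projected Euler schemes and their limits -/

theorem mul_le_sub_of_forall_le_succ_sub {a : ℕ → ℝ} {c : ℝ} {k l : ℕ} (hkl : k ≤ l)
    (h : ∀ i, k ≤ i → i < l → c ≤ a (i + 1) - a i) : ((l : ℝ) - k) * c ≤ a l - a k := by
  induction l, hkl using Nat.le_induction with
  | base => simp
  | succ l hkl ih =>
    have h1 := ih fun i hi hil => h i hi (by lia)
    have h2 := h l hkl (by lia)
    push_cast
    linarith

section Euler

variable {S J : Type*}

/-- The Euler scheme with step `h` in which the prices are projected to `[0, ∞)`. -/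
noncomputable def projectedEuler (f : PriceState S J → PriceState S J) (x₀ : PriceState S J)
    (h : ℝ) : ℕ → PriceState S J
  | 0 => x₀
  | k + 1 =>
    (fun j => max 0 ((projectedEuler f x₀ h k).1 j + h * (f (projectedEuler f x₀ h k)).1 j),
     fun s => (projectedEuler f x₀ h k).2 s + h * (f (projectedEuler f x₀ h k)).2 s)

namespace projectedEuler

variable {f : PriceState S J → PriceState S J} {x₀ : PriceState S J} {h : ℝ}

theorem nonneg (hx₀ : ∀ j, 0 ≤ x₀.1 j) (k : ℕ) (j : J) : 0 ≤ (projectedEuler f x₀ h k).1 j := by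
  cases k with
  | zero => exact hx₀ j
  | succ k => exact le_max_left _ _

theorem le_succ_sub (k : ℕ) (j : J) : h * (f (projectedEuler f x₀ h k)).1 j ≤
    (projectedEuler f x₀ h (k + 1)).1 j - (projectedEuler f x₀ h k).1 j :=
  le_sub_iff_add_le'.2 (le_max_right _ _)

/-- A positive new price shows that the projection did not act. In general only the lower bound
`le_succ_sub` holds, which is why `IsLocallyDrivenBy` is one-sided at zero prices. -/
theorem succ_sub_of_pos {k : ℕ} {j : J} (hpos : 0 < (projectedEuler f x₀ h (k + 1)).1 j) :
    (projectedEuler f x₀ h (k + 1)).1 j - (projectedEuler f x₀ h k).1 j =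
      h * (f (projectedEuler f x₀ h k)).1 j := by
  rw [projectedEuler] at hpos ⊢
  simp only at hpos ⊢
  rw [max_eq_right (((lt_max_iff.1 hpos).resolve_left (lt_irrefl 0)).le), add_sub_cancel_left]

theorem succ_sub_snd (k : ℕ) (s : S) :
    (projectedEuler f x₀ h (k + 1)).2 s - (projectedEuler f x₀ h k).2 s =
      h * (f (projectedEuler f x₀ h k)).2 s :=
  add_sub_cancel_left _ _

variable [Fintype S] [Fintype J] {B : ℝ}

theorem dist_succ_le (hh : 0 ≤ h) (hB : ∀ x, ‖f x‖ ≤ B) (hx₀ : ∀ j, 0 ≤ x₀.1 j) (k : ℕ) :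
    dist (projectedEuler f x₀ h (k + 1)) (projectedEuler f x₀ h k) ≤ h * B := by
  have hB0 : 0 ≤ B := (norm_nonneg _).trans (hB x₀)
  set v := projectedEuler f x₀ h k with hv
  have h1 : ∀ j, |h * (f v).1 j| ≤ h * B := fun j => by
    rw [abs_mul, abs_of_nonneg hh]
    exact mul_le_mul_of_nonneg_left
      (((norm_le_pi_norm (f v).1 j).trans (norm_fst_le _)).trans (hB v)) hh
  have h2 : ∀ s, |h * (f v).2 s| ≤ h * B := fun s => by
    rw [abs_mul, abs_of_nonneg hh]
    exact mul_le_mul_of_nonneg_left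
      (((norm_le_pi_norm (f v).2 s).trans (norm_snd_le _)).trans (hB v)) hh
  have hhB : 0 ≤ h * B := mul_nonneg hh hB0
  rw [Prod.dist_eq]
  refine max_le ((dist_pi_le_iff hhB).2 fun j => ?_) ((dist_pi_le_iff hhB).2 fun s => ?_)
  · rw [Real.dist_eq]
    have h3 : 0 ≤ v.1 j := nonneg hx₀ k j
    calc |(projectedEuler f x₀ h (k + 1)).1 j - v.1 j|
        = |max 0 (v.1 j + h * (f v).1 j) - max 0 (v.1 j)| := by
          rw [max_eq_right h3]
          rfl
      _ ≤ |v.1 j + h * (f v).1 j - v.1 j| := by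
          rw [max_comm 0, max_comm 0]
          exact abs_max_sub_max_le_abs _ _ _
      _ ≤ h * B := by
          rw [add_sub_cancel_left]
          exact h1 j
  · rw [Real.dist_eq, succ_sub_snd]
    exact h2 s

theorem dist_le (hh : 0 ≤ h) (hB : ∀ x, ‖f x‖ ≤ B) (hx₀ : ∀ j, 0 ≤ x₀.1 j) (k l : ℕ) :
    dist (projectedEuler f x₀ h k) (projectedEuler f x₀ h l) ≤ h * B * |(k : ℝ) - l| := by
  wlog hkl : k ≤ l generalizing k l
  · rw [dist_comm, abs_sub_comm]
    exact this l k (le_of_not_ge hkl)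
  have hkl' : (k : ℝ) ≤ l := by exact_mod_cast hkl
  have h1 := dist_le_Ico_sum_of_dist_le hkl (f := projectedEuler f x₀ h) (d := fun _ => h * B)
    fun {i} _ _ => by
      rw [dist_comm]
      exact dist_succ_le hh hB hx₀ i
  rw [Finset.sum_const, Nat.card_Ico, nsmul_eq_mul, Nat.cast_sub hkl] at h1
  rw [abs_sub_comm, abs_of_nonneg (by linarith), mul_comm]
  exact h1

end projectedEuler

variable [Fintype S] [Fintype J]

theorem abs_floor_sub_floor_le (a b : ℝ) : |(⌊a⌋₊ : ℝ) - ⌊b⌋₊| ≤ |a - b| + 1 := by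
  wlog hab : a ≤ b generalizing a b
  · rw [abs_sub_comm, abs_sub_comm a]
    exact this b a (le_of_not_ge hab)
  have h1 : (⌊a⌋₊ : ℝ) ≤ ⌊b⌋₊ := by exact_mod_cast Nat.floor_mono hab
  rw [abs_sub_comm, abs_of_nonneg (by linarith), abs_sub_comm, abs_of_nonneg (by linarith)]
  rcases le_total 0 b with hb | hb
  · linarith [Nat.floor_le hb, Nat.lt_floor_add_one a]
  · rw [Nat.floor_of_nonpos hb, Nat.floor_of_nonpos (hab.trans hb)]
    simp only [Nat.cast_zero]
    linarith

/-- The increments of a curve over short intervals near `t` agree up to `ε` with the values of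
the projected field `f` at `t`; at a vanishing price only the lower bound is required. -/
def IsLocallyDrivenBy (f : PriceState S J → PriceState S J) (X : ℝ → PriceState S J) (t : ℝ) :
    Prop :=
  ∀ ε > 0, ∃ δ > 0, ∀ a b, 0 ≤ a → a ≤ b → |a - t| < δ → |b - t| < δ →
    (∀ j, (b - a) * ((f (X t)).1 j - ε) ≤ (X b).1 j - (X a).1 j) ∧
    (∀ j, 0 < (X t).1 j → (X b).1 j - (X a).1 j ≤ (b - a) * ((f (X t)).1 j + ε)) ∧
    (∀ s, (b - a) * ((f (X t)).2 s - ε) ≤ (X b).2 s - (X a).2 s) ∧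
    (∀ s, (X b).2 s - (X a).2 s ≤ (b - a) * ((f (X t)).2 s + ε))

/-- A bounded field has a Lipschitz curve, a limit of projected Euler schemes, that it drives
wherever it is continuous. -/
theorem exists_projectedEuler_limit {f : PriceState S J → PriceState S J} {B : ℝ}
    (hB : ∀ x, ‖f x‖ ≤ B) {x₀ : PriceState S J} (hx₀ : ∀ j, 0 ≤ x₀.1 j) :
    ∃ X : ℝ → PriceState S J, X 0 = x₀ ∧ LipschitzWith B.toNNReal X ∧
      (∀ t j, 0 ≤ (X t).1 j) ∧
      ∀ t, 0 ≤ t → ContinuousWithinAt f {x | ∀ j, 0 ≤ x.1 j} (X t) → IsLocallyDrivenBy f X t := by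
  have hB0 : 0 ≤ B := (norm_nonneg _).trans (hB x₀)
  set u : ℕ → ℕ → PriceState S J := fun n => projectedEuler f x₀ (1 / ((n : ℝ) + 1))
  set N : ℕ → ℝ → ℕ := fun n t => ⌊t * ((n : ℝ) + 1)⌋₊
  have hh : ∀ n : ℕ, 0 < 1 / ((n : ℝ) + 1) := fun n => by positivity
  have hN : ∀ (n : ℕ) (s t : ℝ),
      1 / ((n : ℝ) + 1) * |(N n s : ℝ) - N n t| ≤ |s - t| + 1 / ((n : ℝ) + 1) := by
    intro n s t
    have h1 := abs_floor_sub_floor_le (s * ((n : ℝ) + 1)) (t * ((n : ℝ) + 1))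
    have h2 : (0 : ℝ) < (n : ℝ) + 1 := by positivity
    rw [← sub_mul, abs_mul, abs_of_pos h2] at h1
    calc _ ≤ 1 / ((n : ℝ) + 1) * (|s - t| * ((n : ℝ) + 1) + 1) := by gcongr
      _ = _ := by field_simp
  have hdist : ∀ (n : ℕ) (s t : ℝ), dist (u n (N n s)) (u n (N n t)) ≤
      B * (|s - t| + 1 / ((n : ℝ) + 1)) := by
    intro n s t
    refine (projectedEuler.dist_le (hh n).le hB hx₀ _ _).trans ?_
    rw [mul_comm _ B, mul_assoc]
    exact mul_le_mul_of_nonneg_left (hN n s t) hB0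
  have hN0 : ∀ n, N n 0 = 0 := fun n => by simp [N]
  -- The schemes at a fixed time stay in a closed ball, so they converge along the ultrafilter at
  -- every time at once. This replaces the extraction of a subsequence.
  set 𝒰 : Ultrafilter ℕ := hyperfilter ℕ
  have h𝒰 : (𝒰 : Filter ℕ) ≤ atTop := Nat.hyperfilter_le_atTop
  have hlim : ∀ t, ∃ x, Tendsto (fun n => u n (N n t)) 𝒰 (𝓝 x) := by
    intro t
    obtain ⟨x, -, hx⟩ := (isCompact_closedBall x₀ (B * (|t| + 1))).ultrafilter_le_nhds
      (𝒰.map fun n => u n (N n t)) (by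
        rw [le_principal_iff, Ultrafilter.mem_coe, Ultrafilter.mem_map]
        refine univ_mem' fun n => Metric.mem_closedBall.2 ?_
        have h1 := hdist n t 0
        rw [hN0, sub_zero] at h1
        refine h1.trans ?_
        gcongr
        rw [div_le_one (by positivity)]
        have : (0 : ℝ) ≤ n := Nat.cast_nonneg n
        linarith)
    exact ⟨x, hx⟩
  choose X hX using hlim
  have hsmall : Tendsto (fun n : ℕ => 1 / ((n : ℝ) + 1)) 𝒰 (𝓝 0) :=
    (tendsto_one_div_add_atTop_nhds_zero_nat (𝕜 := ℝ)).mono_left h𝒰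
  have hNlim : ∀ t, 0 ≤ t → Tendsto (fun n : ℕ => 1 / ((n : ℝ) + 1) * (N n t : ℝ)) 𝒰 (𝓝 t) := by
    intro t ht
    have h1 : Tendsto (fun n : ℕ => (n : ℝ) + 1) atTop atTop :=
      tendsto_atTop_add_const_right _ _ tendsto_natCast_atTop_atTop
    have h2 := (tendsto_nat_floor_mul_div_atTop ht).comp h1
    refine (h2.congr fun n => ?_).mono_left h𝒰
    simp only [Function.comp_apply, N]
    ring
  have hc1 : ∀ j, Continuous fun y : PriceState S J => y.1 j := fun j => by fun_prop
  have hc2 : ∀ s, Continuous fun y : PriceState S J => y.2 s := fun s => by fun_prop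
  refine ⟨X, ?_, LipschitzWith.of_dist_le_mul fun s t => ?_, fun t j => ?_, fun t ht hf ε hε => ?_⟩
  · refine tendsto_nhds_unique (hX 0) ?_
    simp only [hN0]
    exact tendsto_const_nhds
  · rw [Real.coe_toNNReal B hB0, Real.dist_eq]
    refine le_of_tendsto_of_tendsto' ((hX s).dist (hX t)) ?_ fun n => hdist n s t
    simpa using (hsmall.const_add |s - t|).const_mul B
  · exact ge_of_tendsto' (((hc1 j).tendsto _).comp (hX t)) fun n => projectedEuler.nonneg hx₀ _ j
  obtain ⟨η, hη, hball⟩ : ∃ η > 0, ∀ y : PriceState S J, (∀ j, 0 ≤ y.1 j) → dist y (X t) < η →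
      dist (f y) (f (X t)) < ε ∧ ∀ j, 0 < (X t).1 j → 0 < y.1 j := by
    have h1 : ∀ᶠ y in 𝓝 (X t), ∀ j, 0 < (X t).1 j → 0 < y.1 j := by
      refine eventually_all.2 fun j => ?_
      by_cases hj : 0 < (X t).1 j
      · filter_upwards [(hc1 j).continuousAt.eventually (lt_mem_nhds hj)] with y hy _
        exact hy
      · exact Eventually.of_forall fun y hj' => absurd hj' hj
    have h2 := eventually_nhdsWithin_iff.1 (hf.eventually (Metric.ball_mem_nhds _ hε))
    obtain ⟨η, hη, h⟩ := Metric.eventually_nhds_iff.1 (h1.and h2)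
    exact ⟨η, hη, fun y hy hd => ⟨(h hd).2 hy, (h hd).1⟩⟩
  -- Three errors of at most η/4 each keep the scheme within η of X t: convergence at time t, motion
  -- over a time δ at speed B, and rounding of times to the grid.
  refine ⟨η / (4 * (B + 1)), by positivity, fun a b ha hab hat hbt => ?_⟩
  set δ := η / (4 * (B + 1))
  have hδ : B * δ ≤ η / 4 := by
    have h1 : δ * (4 * (B + 1)) = η := by
      simp only [δ]
      field_simp
    have h2 : 0 < δ := by positivity
    nlinarith
  have hab' : ∀ n, N n a ≤ N n b := fun n => Nat.floor_mono (by gcongr)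
  have hnear : ∀ᶠ n in (𝒰 : Filter ℕ), ∀ i, N n a ≤ i → i ≤ N n b → dist (u n i) (X t) < η := by
    have h1 : ∀ᶠ n in (𝒰 : Filter ℕ), dist (u n (N n t)) (X t) < η / 4 :=
      (hX t).eventually (Metric.ball_mem_nhds _ (by positivity))
    have h2 : ∀ᶠ n : ℕ in (𝒰 : Filter ℕ), B * (1 / ((n : ℝ) + 1)) < η / 4 := by
      have h3 := hsmall.const_mul B
      rw [mul_zero] at h3
      exact h3.eventually (gt_mem_nhds (by positivity))
    filter_upwards [h1, h2] with n hn1 hn2 i hai hib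
    have h3 : 1 / ((n : ℝ) + 1) * |(i : ℝ) - N n t| ≤ δ + 1 / ((n : ℝ) + 1) := by
      have h4 : (N n a : ℝ) ≤ i := by exact_mod_cast hai
      have h5 : (i : ℝ) ≤ N n b := by exact_mod_cast hib
      have h6 := abs_le_max_abs_abs (sub_le_sub_right h4 (N n t : ℝ))
        (sub_le_sub_right h5 (N n t : ℝ))
      refine (mul_le_mul_of_nonneg_left h6 (hh n).le).trans ?_
      rw [mul_max_of_nonneg _ _ (hh n).le]
      exact max_le ((hN n a t).trans (by linarith)) ((hN n b t).trans (by linarith))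
    have h4 := projectedEuler.dist_le (hh n).le hB hx₀ i (N n t)
    have h5 : 1 / ((n : ℝ) + 1) * B * |(i : ℝ) - N n t| ≤ B * (δ + 1 / ((n : ℝ) + 1)) := by
      rw [mul_comm _ B, mul_assoc]
      exact mul_le_mul_of_nonneg_left h3 hB0
    have h6 := dist_triangle (u n i) (u n (N n t)) (X t)
    have h7 : dist (u n i) (u n (N n t)) ≤ B * (δ + 1 / ((n : ℝ) + 1)) := h4.trans h5
    linarith
  have hfnear : ∀ᶠ n in (𝒰 : Filter ℕ), ∀ i, N n a ≤ i → i ≤ N n b →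
      (∀ j, |(f (u n i)).1 j - (f (X t)).1 j| ≤ ε) ∧ (∀ s, |(f (u n i)).2 s - (f (X t)).2 s| ≤ ε) ∧
      ∀ j, 0 < (X t).1 j → 0 < (u n i).1 j := by
    filter_upwards [hnear] with n hn i hai hib
    obtain ⟨h1, h2⟩ := hball _ (projectedEuler.nonneg hx₀ i) (hn i hai hib)
    rw [Prod.dist_eq, max_lt_iff] at h1
    exact ⟨fun j => (dist_le_pi_dist _ _ j).trans h1.1.le,
      fun s => (dist_le_pi_dist _ _ s).trans h1.2.le, h2⟩
  have hlen : ∀ c : ℝ, Tendsto (fun n : ℕ => ((N n b : ℝ) - N n a) * (1 / ((n : ℝ) + 1) * c)) 𝒰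
      (𝓝 ((b - a) * c)) := by
    intro c
    refine (((hNlim b (ha.trans hab)).sub (hNlim a ha)).mul_const c).congr fun n => ?_
    ring
  have hd1 : ∀ j, Tendsto (fun n => (u n (N n b)).1 j - (u n (N n a)).1 j) 𝒰
      (𝓝 ((X b).1 j - (X a).1 j)) := fun j =>
    (((hc1 j).tendsto _).comp (hX b)).sub (((hc1 j).tendsto _).comp (hX a))
  have hd2 : ∀ s, Tendsto (fun n => (u n (N n b)).2 s - (u n (N n a)).2 s) 𝒰
      (𝓝 ((X b).2 s - (X a).2 s)) := fun s =>
    (((hc2 s).tendsto _).comp (hX b)).sub (((hc2 s).tendsto _).comp (hX a))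
  refine ⟨fun j => ?_, fun j hj => ?_, fun s => ?_, fun s => ?_⟩
  · refine le_of_tendsto_of_tendsto (hlen _) (hd1 j) ?_
    filter_upwards [hfnear] with n hn
    refine mul_le_sub_of_forall_le_succ_sub (a := fun i => (u n i).1 j) (hab' n)
      fun i hai hib => ?_
    refine le_trans ?_ (projectedEuler.le_succ_sub i j)
    have := (abs_le.1 ((hn i hai hib.le).1 j)).1
    exact mul_le_mul_of_nonneg_left (by linarith) (hh n).le
  · refine le_of_tendsto_of_tendsto (hd1 j) (hlen _) ?_
    filter_upwards [hfnear] with n hn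
    have h1 := mul_le_sub_of_forall_le_succ_sub (a := fun i => -(u n i).1 j)
      (c := -(1 / ((n : ℝ) + 1) * ((f (X t)).1 j + ε))) (hab' n) fun i hai hib => by
        -- Positivity is needed at the index i + 1, which is at most `N n b` because i is strictly
        -- below it.
        have h2 := projectedEuler.succ_sub_of_pos ((hn (i + 1) (by lia) hib).2.2 j hj)
        have h3 := (abs_le.1 ((hn i hai hib.le).1 j)).2
        have h4 := mul_le_mul_of_nonneg_left (sub_le_iff_le_add'.1 h3) (hh n).le
        simp only [u] at h4 ⊢
        linarith
    linarith
  · refine le_of_tendsto_of_tendsto (hlen _) (hd2 s) ?_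
    filter_upwards [hfnear] with n hn
    refine mul_le_sub_of_forall_le_succ_sub (a := fun i => (u n i).2 s) (hab' n)
      fun i hai hib => ?_
    refine le_trans ?_ (projectedEuler.succ_sub_snd i s).ge
    have := (abs_le.1 ((hn i hai hib.le).2.1 s)).1
    exact mul_le_mul_of_nonneg_left (by linarith) (hh n).le
  · refine le_of_tendsto_of_tendsto (hd2 s) (hlen _) ?_
    filter_upwards [hfnear] with n hn
    have h1 := mul_le_sub_of_forall_le_succ_sub (a := fun i => -(u n i).2 s)
      (c := -(1 / ((n : ℝ) + 1) * ((f (X t)).2 s + ε))) (hab' n) fun i hai hib => by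
        have h2 := projectedEuler.succ_sub_snd (f := f) (x₀ := x₀) (h := 1 / ((n : ℝ) + 1)) i s
        have h3 := (abs_le.1 ((hn i hai hib.le).2.1 s)).2
        have h4 := mul_le_mul_of_nonneg_left (sub_le_iff_le_add'.1 h3) (hh n).le
        simp only [u] at h4 ⊢
        linarith
    linarith

theorem hasDerivAt_of_two_sided_bound {g : ℝ → ℝ} {c t : ℝ} (ht : 0 < t)
    (h : ∀ ε > 0, ∃ δ > 0, ∀ a b, 0 ≤ a → a ≤ b → |a - t| < δ → |b - t| < δ →
      (b - a) * (c - ε) ≤ g b - g a ∧ g b - g a ≤ (b - a) * (c + ε)) : HasDerivAt g c t := by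
  rw [hasDerivAt_iff_isLittleO, Asymptotics.isLittleO_iff]
  intro ε hε
  obtain ⟨δ, hδ, hb⟩ := h ε hε
  have hev : ∀ᶠ b in 𝓝 t, |b - t| < δ := Metric.ball_mem_nhds t hδ
  filter_upwards [lt_mem_nhds ht, hev] with b hb0 hbt
  have htt : |t - t| < δ := by simpa using hδ
  rw [smul_eq_mul, Real.norm_eq_abs, Real.norm_eq_abs]
  rcases le_total t b with htb | htb
  · obtain ⟨h1, h2⟩ := hb t b ht.le htb htt hbt
    rw [abs_of_nonneg (sub_nonneg.2 htb), abs_le]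
    constructor <;> nlinarith
  · obtain ⟨h1, h2⟩ := hb b t hb0.le htb hbt htt
    rw [abs_of_nonpos (sub_nonpos.2 htb), abs_le]
    constructor <;> nlinarith

/-- If c > 0, the increments after t would be at least 2c/3 times the length by the lower bound, but
at most c/3 times the length by the zero derivative. -/
theorem nonpos_of_lower_bound {g : ℝ → ℝ} {c t : ℝ} (ht : 0 < t) (hg : HasDerivAt g 0 t)
    (h : ∀ ε > 0, ∃ δ > 0, ∀ a b, 0 ≤ a → a ≤ b → |a - t| < δ → |b - t| < δ →
      (b - a) * (c - ε) ≤ g b - g a) : c ≤ 0 := by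
  by_contra! hc
  obtain ⟨δ, hδ, hb⟩ := h (c / 3) (by positivity)
  rw [hasDerivAt_iff_isLittleO, Asymptotics.isLittleO_iff] at hg
  obtain ⟨δ', hδ', h'⟩ := Metric.eventually_nhds_iff.1 (hg (show 0 < c / 3 by positivity))
  set r := min δ δ' / 2
  have hr : 0 < r := by positivity
  have hr1 : r < δ := (half_lt_self (by positivity)).trans_le (min_le_left _ _)
  have hr2 : r < δ' := (half_lt_self (by positivity)).trans_le (min_le_right _ _)
  have h1 := hb t (t + r) ht.le (by linarith) (by simpa using hδ)
    (by rwa [add_sub_cancel_left, abs_of_pos hr])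
  have h2 := h' (show dist (t + r) t < δ' by
    rwa [Real.dist_eq, add_sub_cancel_left, abs_of_pos hr])
  rw [add_sub_cancel_left, smul_zero, sub_zero, Real.norm_eq_abs, Real.norm_eq_abs,
    abs_of_pos hr] at h2
  have h3 := (le_abs_self _).trans h2
  rw [add_sub_cancel_left] at h1
  nlinarith

/-- A Lipschitz function is differentiable almost everywhere and is the integral of its derivative,
so the derivative need only be identified where it exists. -/
theorem integral_eq_sub_of_ae_hasDerivAt {g w : ℝ → ℝ} {K : NNReal} (hg : LipschitzWith K g)
    {T : ℝ} (hT : 0 ≤ T) (h : ∀ t, 0 < t → t ≤ T → DifferentiableAt ℝ g t → HasDerivAt g (w t) t) :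
    IntervalIntegrable w volume 0 T ∧ g T = g 0 + ∫ t in (0 : ℝ)..T, w t := by
  have hac : AbsolutelyContinuousOnInterval g 0 T :=
    (hg.lipschitzOnWith).absolutelyContinuousOnInterval
  have hae : ∀ᵐ t, t ∈ uIoc 0 T → deriv g t = w t := by
    filter_upwards [hg.ae_differentiableAt_real] with t ht htT
    rw [uIoc_of_le hT] at htT
    exact (h t htT.1 htT.2 ht).deriv
  refine ⟨hac.intervalIntegrable_deriv.congr_ae
    ((ae_restrict_iff' measurableSet_uIoc).2 hae), ?_⟩
  rw [← intervalIntegral.integral_congr_ae hae, hac.integral_deriv_eq_sub]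
  ring

/-- A Lipschitz curve that is driven by `f` solves the projected equation. -/
theorem integral_eq_of_isLocallyDrivenBy {f F : PriceState S J → PriceState S J}
    {X : ℝ → PriceState S J} {K : NNReal} (hX : LipschitzWith K X) (hX0 : ∀ t j, 0 ≤ (X t).1 j)
    {T : ℝ} (hT : 0 ≤ T) (hf : ∀ t, 0 < t → t ≤ T → IsLocallyDrivenBy f X t)
    (hF1 : ∀ t, 0 < t → t ≤ T → ∀ j, (F (X t)).1 j = posProj ((f (X t)).1 j) ((X t).1 j))
    (hF2 : ∀ t, 0 < t → t ≤ T → (F (X t)).2 = (f (X t)).2) :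
    IntervalIntegrable (fun t => F (X t)) volume 0 T ∧
      X T = X 0 + ∫ t in (0 : ℝ)..T, F (X t) := by
  have hl1 : ∀ j, LipschitzWith K fun t => (X t).1 j := fun j => LipschitzWith.of_dist_le_mul
    fun s t => ((dist_le_pi_dist _ _ j).trans (le_max_left _ _)).trans (hX.dist_le_mul s t)
  have hl2 : ∀ i, LipschitzWith K fun t => (X t).2 i := fun i => LipschitzWith.of_dist_le_mul
    fun s t => ((dist_le_pi_dist _ _ i).trans (le_max_right _ _)).trans (hX.dist_le_mul s t)
  have h1 : ∀ j, IntervalIntegrable (fun t => (F (X t)).1 j) volume 0 T ∧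
      (X T).1 j = (X 0).1 j + ∫ t in (0 : ℝ)..T, (F (X t)).1 j := by
    refine fun j => integral_eq_sub_of_ae_hasDerivAt (hl1 j) hT fun t ht htT hd => ?_
    rw [hF1 t ht htT j]
    rcases (hX0 t j).eq_or_lt with h0 | h0
    -- At a zero price the nonnegative coordinate has a minimum, so its derivative is 0 if it
    -- exists. The lower bound then forces the drift to be nonpositive, hence its projection is 0 as
    -- well.
    · have hmin : IsLocalMin (fun t => (X t).1 j) t :=
        Eventually.of_forall fun s => by
          simp only [← h0]
          exact hX0 s j
      have hd0 := hd.hasDerivAt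
      rw [hmin.deriv_eq_zero] at hd0
      have hle := nonpos_of_lower_bound ht hd0 fun ε hε => by
        obtain ⟨δ, hδ, hb⟩ := hf t ht htT ε hε
        exact ⟨δ, hδ, fun a b ha hab hat hbt => (hb a b ha hab hat hbt).1 j⟩
      rw [← h0, posProj_zero_right, max_eq_left hle]
      exact hd0
    · rw [posProj_of_pos h0]
      refine hasDerivAt_of_two_sided_bound ht fun ε hε => ?_
      obtain ⟨δ, hδ, hb⟩ := hf t ht htT ε hε
      exact ⟨δ, hδ, fun a b ha hab hat hbt => ⟨(hb a b ha hab hat hbt).1 j,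
        (hb a b ha hab hat hbt).2.1 j h0⟩⟩
  have h2 : ∀ i, IntervalIntegrable (fun t => (F (X t)).2 i) volume 0 T ∧
      (X T).2 i = (X 0).2 i + ∫ t in (0 : ℝ)..T, (F (X t)).2 i := by
    refine fun i => integral_eq_sub_of_ae_hasDerivAt (hl2 i) hT fun t ht htT _ => ?_
    rw [hF2 t ht htT]
    refine hasDerivAt_of_two_sided_bound ht fun ε hε => ?_
    obtain ⟨δ, hδ, hb⟩ := hf t ht htT ε hε
    exact ⟨δ, hδ, fun a b ha hab hat hbt => ⟨(hb a b ha hab hat hbt).2.2.1 i,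
      (hb a b ha hab hat hbt).2.2.2 i⟩⟩
  have hint : IntervalIntegrable (fun t => F (X t)) volume 0 T :=
    ⟨(integrable_pi_iff.2 fun j => (h1 j).1.1).prodMk (integrable_pi_iff.2 fun i => (h2 i).1.1),
      (integrable_pi_iff.2 fun j => (h1 j).1.2).prodMk (integrable_pi_iff.2 fun i => (h2 i).1.2)⟩
  refine ⟨hint, Prod.ext (funext fun j => ?_) (funext fun i => ?_)⟩
  · have h3 := ((ContinuousLinearMap.proj (R := ℝ) (φ := fun _ : J => ℝ) j).comp
      (ContinuousLinearMap.fst ℝ (J → ℝ) (S → ℝ))).intervalIntegral_comp_comm hint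
    exact (h1 j).2.trans (congrArg ((X 0).1 j + ·) h3)
  · have h3 := ((ContinuousLinearMap.proj (R := ℝ) (φ := fun _ : S => ℝ) i).comp
      (ContinuousLinearMap.snd ℝ (J → ℝ) (S → ℝ))).intervalIntegral_comp_comm hint
    exact (h2 i).2.trans (congrArg ((X 0).2 i + ·) h3)

end Euler

/-! ### Global existence and continuation -/

namespace MultipathSystem

variable {S J R : Type*} {M : MultipathSystem S J R}
variable [Fintype R] [DecidableEq S] [DecidableEq J] [Fintype S] [Fintype J]

theorem Standing.exists_drift_bound (hM : M.Standing) (hH : M.AssumptionH)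
    {K : Set (PriceState S J)} (hK : IsCompact K) (hKΩ : K ⊆ M.stateSpace) :
    ∃ B, 0 ≤ B ∧ ∀ x ∈ K, ‖M.drift x‖ ≤ B := by
  obtain ⟨B, hB⟩ := hK.exists_bound_of_continuousOn ((hM.continuousOn_drift hH).mono hKΩ)
  exact ⟨max 0 B, le_max_left _ _, fun x hx => (hB x hx).trans (le_max_right _ _)⟩

theorem Standing.norm_field_le (hM : M.Standing) {x : PriceState S J} (hx : x ∈ M.stateSpace) :
    ‖M.field x‖ ≤ ‖M.drift x‖ := by
  rw [Prod.norm_def, field_snd]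
  refine max_le ((pi_norm_le_iff_of_nonneg (norm_nonneg _)).2 fun j => ?_) (norm_snd_le _)
  rw [hM.field_fst (hx.1 j)]
  exact (abs_posProj_le _ _).trans ((norm_le_pi_norm (M.drift x).1 j).trans (norm_fst_le _))

/-- Cut off outside a compact set, the drift is bounded and has a Euler limit curve. While the curve
stays in `U` it solves the true equation, so V does not increase and the curve is in fact in the
smaller closed set `L`. As `U` is a relatively open neighbourhood of `L`, it never leaves. -/
theorem Standing.exists_isSolutionOn_Ici (hM : M.Standing) (hH : M.AssumptionH)
    {x₀ : PriceState S J} (hx₀ : x₀ ∈ M.stateSpace) :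
    ∃ X : ℝ → PriceState S J, M.IsSolutionOn (Ici 0) X ∧ X 0 = x₀ := by
  -- The margin 1 above the initial potential makes the cutoff invisible near the states that the
  -- curve can reach.
  obtain ⟨K, hK, hKΩ, hsub⟩ := hM.sublevel_subset_compact hH (M.potential x₀ + 1)
  obtain ⟨B, hB0, hB⟩ := hM.exists_drift_bound hH hK hKΩ
  have hBf : ∀ x, ‖K.indicator M.drift x‖ ≤ B := by
    intro x
    by_cases hx : x ∈ K
    · rw [indicator_of_mem hx]
      exact hB x hx
    · rw [indicator_of_notMem hx, norm_zero]
      exact hB0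
  obtain ⟨X, hX0, hXL, hXnonneg, hXd⟩ := exists_projectedEuler_limit hBf hx₀.1
  set U : Set (PriceState S J) := {x | x ∈ M.stateSpace ∧ M.potential x < M.potential x₀ + 1}
  set L : Set (PriceState S J) := K ∩ M.potential ⁻¹' Iic (M.potential x₀)
  have hUK : U ⊆ K := fun x hx => hsub x hx.1 hx.2.le
  have hLU : L ⊆ U := fun x hx => ⟨hKΩ hx.1, lt_of_le_of_lt hx.2 (lt_add_one _)⟩
  have hVc := hM.continuousOn_potential hH
  have hL : IsClosed L := (hVc.mono hKΩ).preimage_isClosed_of_isClosed hK.isClosed isClosed_Iic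
  have hUopen : ∀ x ∈ U, ∀ᶠ y in 𝓝[{x | ∀ j, 0 ≤ x.1 j}] x, y ∈ U := by
    intro x hx
    have h1 := eventually_nhdsWithin_iff.2 (eventually_mem_stateSpace hx.1)
    have h2 : ContinuousWithinAt M.potential {x | ∀ j, 0 ≤ x.1 j} x :=
      (hVc x hx.1).mono_of_mem_nhdsWithin h1
    filter_upwards [h1, h2.eventually (gt_mem_nhds hx.2)] with y hy1 hy2
    exact ⟨hy1, hy2⟩
  have hcont : ∀ x ∈ U,
      ContinuousWithinAt (K.indicator M.drift) {x | ∀ j, 0 ≤ x.1 j} x := by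
    intro x hx
    have h1 := eventually_nhdsWithin_iff.2 (eventually_mem_stateSpace hx.1)
    have h2 : ContinuousWithinAt M.drift {x | ∀ j, 0 ≤ x.1 j} x :=
      (hM.continuousOn_drift hH x hx.1).mono_of_mem_nhdsWithin h1
    refine h2.congr_of_eventuallyEq ?_ (indicator_of_mem (hUK hx) _)
    filter_upwards [hUopen x hx] with y hy
    exact indicator_of_mem (hUK hy) _
  have hsol : ∀ T, (∀ t ∈ Icc 0 T, X t ∈ U) → M.IsSolutionOn (Icc 0 T) X := by
    intro T hT t ht
    have hU : ∀ τ, 0 < τ → τ ≤ t → X τ ∈ U := fun τ h0 hτ => hT τ ⟨h0.le, hτ.trans ht.2⟩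
    refine ⟨(hT t ht).1, integral_eq_of_isLocallyDrivenBy (f := K.indicator M.drift) hXL hXnonneg
      ht.1 (fun τ h0 hτ => hXd τ h0.le (hcont _ (hU τ h0 hτ))) (fun τ h0 hτ j => ?_)
      fun τ h0 hτ => ?_⟩
    · rw [indicator_of_mem (hUK (hU τ h0 hτ)), hM.field_fst (hXnonneg τ j)]
    · rw [indicator_of_mem (hUK (hU τ h0 hτ)), field_snd]
  have hsolL : ∀ T, (∀ t ∈ Icc 0 T, X t ∈ U) → ∀ t ∈ Icc 0 T, X t ∈ L := by
    intro T hT t ht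
    have h1 := hM.potential_antitone hH (hsol T hT) ⟨le_rfl, ht.1.trans ht.2⟩ ht ht.1
    simp only [hX0] at h1
    exact ⟨hUK (hT t ht), h1⟩
  -- Scaling by θ expresses that the whole segment [0, t] is mapped into `L` as a closed condition
  -- on t, which suits the continuity induction on an interval.
  have hmain : ∀ T, Icc 0 T ⊆ {t | ∀ θ ∈ Icc (0 : ℝ) 1, X (θ * t) ∈ L} := by
    intro T
    refine IsClosed.Icc_subset_of_forall_exists_gt ?_ ?_ ?_
    · refine IsClosed.inter ?_ isClosed_Icc
      simp only [ofPred_forall]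
      exact isClosed_iInter fun θ => isClosed_iInter fun _ =>
        hL.preimage (hXL.continuous.comp (continuous_const.mul continuous_id))
    · intro θ _
      rw [mul_zero, hX0]
      exact ⟨hsub _ hx₀ (by linarith), le_refl (M.potential x₀)⟩
    · rintro x ⟨hx, hxT⟩ y hxy
      have hbefore : ∀ t ∈ Icc 0 x, X t ∈ L := by
        intro t ht
        rcases ht.1.eq_or_lt with h0 | h0
        · have := hx 0 ⟨le_rfl, zero_le_one⟩
          rwa [zero_mul, h0] at this
        · have hx0 : 0 < x := h0.trans_le ht.2
          have := hx (t / x) ⟨by positivity, (div_le_one hx0).2 ht.2⟩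
          rwa [div_mul_cancel₀ _ hx0.ne'] at this
      have hev : ∀ᶠ t in 𝓝 x, X t ∈ U :=
        (tendsto_nhdsWithin_iff (s := {x : PriceState S J | ∀ j, 0 ≤ x.1 j}).2
          ⟨hXL.continuous.tendsto x, Eventually.of_forall fun t => hXnonneg t⟩).eventually
            (hUopen _ (hLU (hbefore x ⟨hxT.1, le_rfl⟩)))
      obtain ⟨δ, hδ, hball⟩ := Metric.eventually_nhds_iff.1 hev
      have hxy : x < y := hxy
      refine ⟨min y (x + δ / 2), fun θ hθ => ?_, lt_min hxy (by linarith), min_le_left _ _⟩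
      have h0 : 0 ≤ min y (x + δ / 2) := hxT.1.trans (le_min hxy.le (by linarith))
      refine hsolL (min y (x + δ / 2)) (fun t ht => ?_) _
        ⟨mul_nonneg hθ.1 h0, mul_le_of_le_one_left h0 hθ.2⟩
      rcases le_total t x with htx | htx
      · exact hLU (hbefore t ⟨ht.1, htx⟩)
      · refine hball ?_
        have := ht.2.trans (min_le_right _ _)
        rw [Real.dist_eq, abs_of_nonneg (sub_nonneg.2 htx)]
        linarith
  have hXL' : ∀ t, 0 ≤ t → X t ∈ L := fun t ht => by
    simpa using hmain t ⟨ht, le_rfl⟩ 1 ⟨zero_le_one, le_rfl⟩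
  exact ⟨X, fun t ht => hsol t (fun τ hτ => hLU (hXL' τ hτ.1)) t ⟨ht, le_rfl⟩, hX0⟩

/-- A solution on a bounded interval has a limit, in the state space, at the right end. -/
theorem Standing.integrable_and_mem_of_isSolutionOn_Ico (hM : M.Standing) (hH : M.AssumptionH)
    {T : ℝ} (hT : 0 < T) {X : ℝ → PriceState S J} (hX : M.IsSolutionOn (Ico 0 T) X) :
    IntervalIntegrable (fun τ => M.field (X τ)) volume 0 T ∧
      X 0 + ∫ τ in (0 : ℝ)..T, M.field (X τ) ∈ M.stateSpace := by
  obtain ⟨K, hK, hKΩ, hsub⟩ := hM.sublevel_subset_compact hH (M.potential (X 0))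
  obtain ⟨B, hB0, hB⟩ := hM.exists_drift_bound hH hK hKΩ
  have hXK : ∀ t ∈ Ico 0 T, X t ∈ K := by
    intro t ht
    have hX' : M.IsSolutionOn (Icc 0 t) X := hX.mono fun τ hτ => ⟨hτ.1, hτ.2.trans_lt ht.2⟩
    exact hsub _ (hX t ht).1 (hM.potential_antitone hH hX' ⟨le_rfl, ht.1⟩ ⟨ht.1, le_rfl⟩ ht.1)
  have hFB : ∀ t ∈ Ico 0 T, ‖M.field (X t)‖ ≤ B := fun t ht =>
    (hM.norm_field_le (hX t ht).1).trans (hB _ (hXK t ht))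
  -- Times in [0, T) that increase to T. The field is bounded along the solution, so its integrals
  -- up to these times are bounded, which gives integrability up to T.
  set b : ℕ → ℝ := fun n => T - T * (1 / ((n : ℝ) + 1))
  have hb : ∀ n, b n ∈ Ico 0 T := by
    intro n
    have h1 : 1 / ((n : ℝ) + 1) ≤ 1 := by
      rw [div_le_one (by positivity)]
      linarith [(Nat.cast_nonneg n : (0 : ℝ) ≤ n)]
    have h2 : 0 < 1 / ((n : ℝ) + 1) := by positivity
    constructor
    · have := mul_le_mul_of_nonneg_left h1 hT.le
      simp only [b]
      linarith
    · have := mul_pos hT h2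
      simp only [b]
      linarith
  have hbT : Tendsto b atTop (𝓝 T) := by
    have h1 := ((tendsto_one_div_add_atTop_nhds_zero_nat (𝕜 := ℝ)).const_mul T).const_sub T
    rwa [mul_zero, sub_zero] at h1
  have hint : IntervalIntegrable (fun τ => M.field (X τ)) volume 0 T := by
    rw [intervalIntegrable_iff_integrableOn_Ioc_of_le hT.le]
    refine integrableOn_Ioc_of_intervalIntegral_norm_bounded_right (I := B * T) (l := atTop)
      (fun n => (intervalIntegrable_iff_integrableOn_Ioc_of_le (hb n).1).1 (hX _ (hb n)).2.1)
      hbT (Eventually.of_forall fun n => ?_)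
    rw [← intervalIntegral.integral_of_le (hb n).1]
    have h1 := intervalIntegral.norm_integral_le_of_norm_le_const (a := 0) (b := b n) (C := B)
      (f := fun τ => ‖M.field (X τ)‖) fun τ hτ => by
        rw [uIoc_of_le (hb n).1] at hτ
        rw [norm_norm]
        exact hFB τ ⟨hτ.1.le, hτ.2.trans_lt (hb n).2⟩
    rw [sub_zero, abs_of_nonneg (hb n).1] at h1
    exact (Real.le_norm_self _).trans (h1.trans (mul_le_mul_of_nonneg_left (hb n).2.le hB0))
  refine ⟨hint, hKΩ ?_⟩
  have hc := intervalIntegral.continuousOn_primitive_interval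
    (f := fun τ => M.field (X τ)) (μ := volume) (a := 0) (b := T) (by
      rw [uIcc_of_le hT.le]
      exact (intervalIntegrable_iff_integrableOn_Icc_of_le hT.le).1 hint)
  rw [uIcc_of_le hT.le] at hc
  have hlim : Tendsto (fun n => X 0 + ∫ τ in (0 : ℝ)..b n, M.field (X τ)) atTop
      (𝓝 (X 0 + ∫ τ in (0 : ℝ)..T, M.field (X τ))) :=
    ((hc T ⟨hT.le, le_rfl⟩).tendsto.comp (tendsto_nhdsWithin_iff.2
      ⟨hbT, Eventually.of_forall fun n => ⟨(hb n).1, (hb n).2.le⟩⟩)).const_add _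
  refine hK.isClosed.mem_of_tendsto hlim (Eventually.of_forall fun n => ?_)
  rw [← (hX _ (hb n)).2.2]
  exact hXK _ (hb n)

/-- A global solution started at the limit at time T is shifted by T and glued on. The integrals
over [0, T] and [T, t] add up; the value at T itself, where the curves are switched, does not affect
the first one. -/
theorem Standing.exists_extension (hM : M.Standing) (hH : M.AssumptionH)
    {T : ℝ} (hT : 0 < T) {X : ℝ → PriceState S J} (hX : M.IsSolutionOn (Ico 0 T) X) :
    ∃ Y : ℝ → PriceState S J, M.IsSolutionOn (Ici 0) Y ∧ EqOn Y X (Ico 0 T) := by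
  obtain ⟨hint, hmem⟩ := hM.integrable_and_mem_of_isSolutionOn_Ico hH hT hX
  obtain ⟨Z, hZ, hZ0⟩ := hM.exists_isSolutionOn_Ici hH hmem
  set Y : ℝ → PriceState S J := fun t => if t < T then X t else Z (t - T)
  have hYX : ∀ t, t < T → Y t = X t := fun t ht => if_pos ht
  have hYZ : ∀ t, T ≤ t → Y t = Z (t - T) := fun t ht => if_neg ht.not_gt
  refine ⟨Y, fun t ht => ?_, fun t ht => hYX t ht.2⟩
  have h0 : Y 0 = X 0 := hYX 0 hT
  have ht : 0 ≤ t := ht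
  rcases lt_or_ge t T with htT | htT
  · obtain ⟨h1, h2, h3⟩ := hX t ⟨ht, htT⟩
    have heq : EqOn (fun τ => M.field (X τ)) (fun τ => M.field (Y τ)) (uIcc 0 t) := by
      intro τ hτ
      rw [uIcc_of_le ht] at hτ
      simp only [hYX τ (hτ.2.trans_lt htT)]
    rw [h0, hYX t htT]
    refine ⟨h1, h2.congr_uIoo (heq.mono uIoo_subset_uIcc_self), h3.trans ?_⟩
    rw [intervalIntegral.integral_congr heq]
  · obtain ⟨h1, h2, h3⟩ := hZ (t - T) (sub_nonneg.2 htT)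
    have heqX : EqOn (fun τ => M.field (X τ)) (fun τ => M.field (Y τ)) (uIoo 0 T) := by
      intro τ hτ
      rw [uIoo_of_le hT.le] at hτ
      simp only [hYX τ hτ.2]
    have heqZ : EqOn (fun τ => M.field (Z (τ - T))) (fun τ => M.field (Y τ)) (uIcc T t) := by
      intro τ hτ
      rw [uIcc_of_le htT] at hτ
      simp only [hYZ τ hτ.1]
    have hiX := hint.congr_uIoo heqX
    have hiZ : IntervalIntegrable (fun τ => M.field (Y τ)) volume T t := by
      have h4 := h2.comp_sub_right T
      rw [zero_add, sub_add_cancel] at h4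
      exact h4.congr_uIoo (heqZ.mono uIoo_subset_uIcc_self)
    rw [h0, hYZ t htT]
    refine ⟨h1, hiX.trans hiZ, ?_⟩
    rw [← intervalIntegral.integral_add_adjacent_intervals hiX hiZ,
      ← intervalIntegral.integral_congr heqZ, ← intervalIntegral.integral_congr_uIoo heqX,
      intervalIntegral.integral_comp_sub_right (fun τ => M.field (Z τ)), sub_self, ← add_assoc,
      ← hZ0]
    exact h3

end MultipathSystem

theorem theorem2 {S J R : Type*} [Fintype S] [Fintype J] [Fintype R]
    [DecidableEq S] [DecidableEq J] (M : MultipathSystem S J R)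
    (hM : M.Standing) (hrank : M.FullRowRank) (hH : M.AssumptionH) :
    ∃ e : PriceState S J, M.IsEquilibrium e ∧ (∀ e', M.IsEquilibrium e' → e' = e) ∧
      M.IsGloballyAsymptoticallyStable e := by
  obtain ⟨e, he⟩ := hM.exists_isEquilibrium hH
  refine ⟨e, he, fun e' he' => ?_, fun ε hε => hM.stable hrank hH he hε,
    fun x₀ hx₀ => hM.exists_isSolutionOn_Ici hH hx₀,
    fun T hT X hX => hM.exists_extension hH hT hX,
    fun X hX => hM.attractive hrank hH he hX⟩
  rcases le_total (M.potential e') (M.potential e) with h | h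
  · exact hM.eq_of_potential_le hrank hH he he'.1 h
  · exact (hM.eq_of_potential_le hrank hH he' he.1 h).symm
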